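/- **Setting.** Let $n\ge 0$ and let $X$ be an abstract simplicial complex, containing the empty simplex; $X(k)$ denotes the set of simplices with $k+1$ vertices. Assume: - $X$ is *pure $n$-dimensional*: $X(n+1)=\emptyset$, $X(n)\neq\emptyset$, and every simplex is contained in an element of $X(n)$; - $X$ is *partite*: its vertex set is partitioned as $V_0\sqcup\dots\sqcup V_n$ and every $\sigma\in X(n)$ has exactly one vertex in each $V_i$. The type of a simplex $\tau$ is $\{i:\tau\cap V_i\ne\emptyset\}$; - $X$ is *gallery connected*: any $\sigma,\sigma'\in X(n)$ are joined by a sequence $\sigma=\sigma_0,\dots,\sigma_l=\sigma'$ in $X(n)$ with $\sigma_i\cap\sigma_{i+1}\in X(n-1)$ for $0\le i\le l-1$; - for every $\eta\in X(n-2)$ the link $X_\eta=\{\tau\in X:\tau\cap\eta=\emptyset,\ \tau\cup\eta\in X\}$ is a finite connected graph. Let $G$ be a locally compact unimodular group acting on $X$ by simplicial automorphisms and cocompactly (finitely many orbits of simplices), such that for every $\tau\in X(n-2)\cup X(n-1)\cup X(n)$ the stabilizer $G_\tau$ is open and compact. For $\eta\in X(n-2)$ let $\lambda_\eta$ be the second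 largest eigenvalue of the random walk operator $(A\phi)(v)=\frac1{\deg v}\sum_{u\sim v}\phi(u)$ on the graph $X_\eta$. For $i\ne j$ in $\{0,\dots,n\}$ let $\lambda_{i,j}$ be the maximum of $\lambda_\eta$ over all $\eta\in X(n-2)$ of type $\{0,\dots,n\}\setminus\{i,j\}$. Let $\mathcal A(X)$ be the real symmetric $(n+1)\times(n+1)$ matrix with $1$ on the diagonal and $-\lambda_{i,j}$ at each off-diagonal position $(i,j)$. A *Kazhdan pair* of $G$ is a pair $(K,\varepsilon)$, $K\subseteq G$, such that for every continuous unitary representation $\pi$ of $G$ on a complex Hilbert space without nonzero $G$-invariant vectors and every unit vector $x$ one has $\sup_{g\in K}\|\pi(g)x-x\|\ge\varepsilon$. The group $G$ has *property (T)* if it has a Kazhdan pair with $K$ compact and $\varepsilon>0$. **Theorem.** Assume that $\mathcal A(X)$ is positive definite. Then $G$ has property (T). Moreover, suppose that the action is type-preserving, i.e. $\tau$ and $g\tau$ have the same type for all $g\in G$, $\tau\in X$. Let $\lambda_X>0$ be the smallest eigenvalue of $\mathcal A(X)$, let $D\subseteq X(n)$ contain exactly one element of each $G$-orbit on $X(n)$,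 and put $$K=\{g\in G:\ \exists\,\sigma,\sigma'\in D,\ |g\sigma'\cap\sigma|\ge n\},\qquad \varepsilon=\frac{1}{2\left(1+\sqrt{\frac{n+1}{\lambda_X}}\right)}.$$ Then $K$ is compact and $(K,\varepsilon)$ is a Kazhdan pair of $G$. -/

import Mathlib

open scoped Pointwise

universe u v w

noncomputable section

namespace PartiteT

/-! ### Simplicial complexes -/

section Complexes

variable {V : Type*} [DecidableEq V]

/-- `X(k)`: the simplices with `k + 1` vertices.  The empty simplex, which Mathlib leaves out of
`X.faces`, belongs to the complex here, so that `X(-1) = {∅}`. -/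
def cells (X : PreAbstractSimplicialComplex V) (k : ℤ) : Set (Finset V) :=
  {τ | (τ ∈ X.faces ∨ τ = ∅) ∧ (τ.card : ℤ) = k + 1}

/-- `X` is pure `n`-dimensional. -/
def IsPure (X : PreAbstractSimplicialComplex V) (n : ℕ) : Prop :=
  cells X (n + 1) = ∅ ∧ (cells X n).Nonempty ∧ ∀ τ ∈ X.faces, ∃ σ ∈ cells X n, τ ⊆ σ

/-- Any two `n`-simplices are joined by a finite sequence of `n`-simplices in which consecutive
ones meet in an `(n-1)`-simplex. -/
def IsGalleryConnected (X : PreAbstractSimplicialComplex V) (n : ℕ) : Prop :=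
  ∀ σ ∈ cells X n, ∀ σ' ∈ cells X n,
    Relation.ReflTransGen
      (fun a b => a ∈ cells X n ∧ b ∈ cells X n ∧ a ∩ b ∈ cells X ((n : ℤ) - 1)) σ σ'

/-- The link of the simplex `τ`. -/
def link (X : PreAbstractSimplicialComplex V) (τ : Finset V) : PreAbstractSimplicialComplex V where
  faces := {η | η.Nonempty ∧ Disjoint τ η ∧ τ ∪ η ∈ X.faces}
  isRelLowerSet_faces := by
    rintro η ⟨hne, hd, hu⟩
    refine ⟨hne, fun η' hle hne' => ⟨hne', hd.mono_right hle, ?_⟩⟩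
    exact (X.isRelLowerSet_faces hu).2 (Finset.union_subset_union_right hle)
      (hne'.mono Finset.subset_union_right)

/-- The graph formed by the vertices and the edges of a complex. -/
def graph (X : PreAbstractSimplicialComplex V) : SimpleGraph {v : V // {v} ∈ X.faces} where
  Adj u v := u ≠ v ∧ ({u.1, v.1} : Finset V) ∈ X.faces
  symm := ⟨fun u v h => ⟨h.1.symm, by rw [Finset.pair_comm]; exact h.2⟩⟩
  loopless := ⟨fun _ h => h.1 rfl⟩

/-- The links of the `(n-2)`-simplices (which are the 1-dimensional links of a pure
`n`-dimensional complex) are finite connected graphs. -/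
def HasFiniteConnectedLinks (X : PreAbstractSimplicialComplex V) (n : ℕ) : Prop :=
  ∀ τ ∈ cells X ((n : ℤ) - 2),
    Finite {v : V // {v} ∈ (link X τ).faces} ∧ (graph (link X τ)).Connected

/-- The partition of the vertices into the fibres of `c` makes `X` partite: each `n`-simplex has
exactly one vertex in each part. -/
def IsPartite (X : PreAbstractSimplicialComplex V) (n : ℕ) (c : V → Fin (n + 1)) : Prop :=
  ∀ σ ∈ cells X n, ∀ i, ∃! v, v ∈ σ ∧ c v = i

end Complexes

/-! ### Random walks on graphs -/

section Walks

variable {W : Type*}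

/-- The random walk `(A φ)(v) = (1 / m(v)) ∑_{u ∼ v} φ(u)`, with `m(v)` the degree of `v`. -/
def randomWalk (Γ : SimpleGraph W) (φ : W → ℂ) : W → ℂ :=
  fun v => (1 / ((Γ.neighborSet v).ncard : ℂ)) * ∑ᶠ u ∈ Γ.neighborSet v, φ u

/-- The real eigenvalues of the random walk (on a finite graph all eigenvalues are real). -/
def walkEigenvalues (Γ : SimpleGraph W) : Set ℝ :=
  {r | ∃ φ : W → ℂ, φ ≠ 0 ∧ randomWalk Γ φ = (r : ℂ) • φ}

/-- The second largest eigenvalue of the random walk on a finite connected graph with an edge: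
the eigenvalue `1` is the largest one and is simple, so this is the largest eigenvalue `< 1`. -/
def secondEigenvalue (Γ : SimpleGraph W) : ℝ :=
  sSup {r | r ∈ walkEigenvalues Γ ∧ r < 1}

end Walks

/-! ### The matrix `A(X)` -/

section Matrix

variable {V : Type*} [DecidableEq V]

/-- `λ_{i,j}`: the maximum of the second largest eigenvalues of the links of the
`(n-2)`-simplices of type `{0, …, n} \ {i, j}`. -/
def linkLambda (X : PreAbstractSimplicialComplex V) (n : ℕ) (c : V → Fin (n + 1))
    (i j : Fin (n + 1)) : ℝ :=
  sSup {r | ∃ η ∈ cells X ((n : ℤ) - 2), η.image c = ({i, j} : Finset (Fin (n + 1)))ᶜ ∧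
    r = secondEigenvalue (graph (link X η))}

/-- The matrix with `1` on the diagonal and `-λ_{i,j}` off the diagonal. -/
def linkMatrix (X : PreAbstractSimplicialComplex V) (n : ℕ) (c : V → Fin (n + 1)) :
    Matrix (Fin (n + 1)) (Fin (n + 1)) ℝ :=
  Matrix.of fun i j => if i = j then 1 else -linkLambda X n c i j

end Matrix

/-! ### Group actions -/

section Actions

variable {V : Type*} [DecidableEq V] (G : Type*) [Group G] [MulAction G V]

/-- The action on the vertices is an action on the complex `X`. -/
def ActsOn (X : PreAbstractSimplicialComplex V) : Prop :=
  ∀ (g : G), ∀ τ ∈ X.faces, g • τ ∈ X.faces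

/-- There are finitely many orbits of simplices. -/
def ActsCocompactly (X : PreAbstractSimplicialComplex V) : Prop :=
  ∃ F : Set (Finset V), F.Finite ∧ F ⊆ X.faces ∧ ∀ τ ∈ X.faces, ∃ σ ∈ F, ∃ g : G, g • σ = τ

/-- The action preserves the types of the simplices. -/
def ActsTypePreserving (X : PreAbstractSimplicialComplex V) {n : ℕ} (c : V → Fin (n + 1)) : Prop :=
  ∀ (g : G), ∀ τ ∈ X.faces, (g • τ).image c = τ.image c

/-- `D` contains exactly one representative of each orbit of `G` on the set `S` of simplices. -/
def IsFundamentalDomain (S D : Set (Finset V)) : Prop :=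
  D ⊆ S ∧ ∀ σ ∈ S, ∃! σ' : Finset V, σ' ∈ D ∧ ∃ g : G, g • σ' = σ

/-- The set `K` of those `g` for which there are `σ, σ' ∈ D` with `|g σ' ∩ σ| ≥ n`. -/
def kazhdanSet (n : ℕ) (D : Set (Finset V)) : Set G :=
  {g | ∃ σ ∈ D, ∃ σ' ∈ D, n ≤ (g • σ' ∩ σ).card}

end Actions

/-! ### Unimodularity and property (T) -/

/-- The modular character of the locally compact group `G` is trivial. -/
def IsUnimodular (G : Type*) [Group G] [TopologicalSpace G] [IsTopologicalGroup G]
    [LocallyCompactSpace G] : Prop :=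
  ∀ g : G, MeasureTheory.Measure.modularCharacter g = 1

/-- `(K, ε)` is a Kazhdan pair of `G`: for each (strongly) continuous unitary representation `π`
of `G` on a complex Hilbert space without nonzero invariant vectors and each unit vector `x`,
`sup_{g ∈ K} ‖π(g) x - x‖ ≥ ε`. -/
def IsKazhdanPair (G : Type u) [Group G] [TopologicalSpace G] (K : Set G) (ε : ℝ) : Prop :=
  ∀ (H : Type w) [NormedAddCommGroup H] [InnerProductSpace ℂ H] [CompleteSpace H]
    (π : G →* (H ≃ₗᵢ[ℂ] H)), (∀ x : H, Continuous fun g : G => π g x) →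
    (∀ x : H, (∀ g : G, π g x = x) → x = 0) →
    ∀ x : H, ‖x‖ = 1 → ε ≤ ⨆ g : K, ‖π g x - x‖

/-- Kazhdan's property (T): there is a Kazhdan pair `(K, ε)` with `K` compact and `ε > 0`. -/
def HasPropertyT (G : Type u) [Group G] [TopologicalSpace G] : Prop :=
  ∃ (K : Set G) (ε : ℝ), IsCompact K ∧ 0 < ε ∧ IsKazhdanPair.{u, w} G K ε

end PartiteT

end

/-! The proof bounds angles between averaging projections on functions of chambers (the elements of
X(n)). Suppose first that the action is type-preserving, and let π be a unitary representation on H.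
The functions φ from chambers to H with φ(gσ) = π(g)φ(σ) form a Hilbert space, orbit representatives
being weighted by the inverse Haar measures of their stabilizers. For each type i let P_i average
over the chambers that share the panel opposite to the vertex of type i. Unimodularity gives a mass
transport identity (`card_mul_measure_stabilizer`), which makes P_i an orthogonal projection.

The chambers around a simplex η of type {0,…,n} ∖ {i,j} are the edges of the bipartite graph X_η,
and a function in the image of P_i or P_j depends on one end of each edge only. So the spectral gap
of X_η bounds by λ_{i,j} the cosine of the angle between these images, once the averages around each
η are removed (`two_mul_sum_inner_le`). A computation with three vectors carries the bound over to
the complements 1 − P_i and 1 − P_j (`neg_mul_le_inner_sub_sub`). Hence Δ = Σ(1 − P_i) satisfies Δ²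
≥ λ_X Δ, and λ_X times the squared distance from φ to ker Δ is at most Σ‖φ − P_iφ‖²
(`exists_fixed_norm_sub_sq_le`). By gallery connectedness the elements of ker Δ are constant, so
their values are invariant vectors.

A vector x that K moves by at most δ yields an equivariant φ that is δ-close to x on every chamber
sharing a panel with a member of D; thus each ‖φ − P_iφ‖² is at most δ² times the total weight. Some
φ(d) is then within δ√((n+1)/λ_X) of an invariant vector, and x is within δ(1 + √((n+1)/λ_X)) of it.
If only 0 is invariant, this bounds δ from below, by twice the stated ε.

In general G permutes the types, and the kernel S of this permutation action is open of finite
index. The argument for S gives an S-invariant vector near x; the sum of its translates over G/S is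
G-invariant, hence 0. Adding coset representatives to the compact set of S therefore gives a Kazhdan
pair of G. -/

namespace PartiteT

/-! ### Projections in real Hilbert spaces -/

section Projections

variable {E : Type*} [NormedAddCommGroup E] [InnerProductSpace ℝ E]

open scoped RealInnerProductSpace

/-- If `f`, `g` are projections of `x` and the angle of `f`, `g` is bounded below, so is the angle
of the complementary projections of `x`. -/
theorem neg_mul_le_inner_sub_sub {x f g : E} {l : ℝ} (hl0 : 0 ≤ l) (hl1 : l < 1)
    (hf : ⟪x, f⟫ = ⟪f, f⟫) (hg : ⟪x, g⟫ = ⟪g, g⟫) (hfg : |⟪f, g⟫| ≤ l * (‖f‖ * ‖g‖)) :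
    -(l * (‖x - g‖ * ‖x - f‖)) ≤ ⟪x - g, x - f⟫ := by
  obtain ⟨a, ha⟩ : ∃ a, a = ⟪f, f⟫ := ⟨_, rfl⟩
  obtain ⟨b, hb⟩ : ∃ b, b = ⟪g, g⟫ := ⟨_, rfl⟩
  obtain ⟨N, hN⟩ : ∃ N, N = ⟪x, x⟫ := ⟨_, rfl⟩
  obtain ⟨s, hs⟩ : ∃ s, s = ⟪f, g⟫ := ⟨_, rfl⟩
  have hgf : ⟪g, f⟫ = s := by rw [real_inner_comm, hs]
  have hfx : ⟪f, x⟫ = a := by rw [real_inner_comm, hf, ha]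
  have hgx : ⟪g, x⟫ = b := by rw [real_inner_comm, hg, hb]
  have hT : ⟪x - g, x - f⟫ = N - a - b + s := by
    simp only [inner_sub_left, inner_sub_right, hf, hgx, hgf, ← ha, ← hN]; ring
  have hp : ‖x - g‖ ^ 2 = N - b := by
    rw [← real_inner_self_eq_norm_sq]
    simp only [inner_sub_left, inner_sub_right, hg, hgx, ← hb, ← hN]; ring
  have hq : ‖x - f‖ ^ 2 = N - a := by
    rw [← real_inner_self_eq_norm_sq]
    simp only [inner_sub_left, inner_sub_right, hf, hfx, ← ha, ← hN]; ring
  have ha2 : ‖f‖ ^ 2 = a := by rw [← real_inner_self_eq_norm_sq, ha]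
  have hb2 : ‖g‖ ^ 2 = b := by rw [← real_inner_self_eq_norm_sq, hb]
  have hpq0 : 0 ≤ ‖x - g‖ * ‖x - f‖ := by positivity
  have hrhs0 : 0 ≤ l * (‖x - g‖ * ‖x - f‖) := by positivity
  rw [hT]
  rw [← hs] at hfg
  obtain ⟨hs1, -⟩ := abs_le.1 hfg
  -- If `N ≥ a + b`, the inner product is at least `s` and the complements are at least as long as
  -- `f` and `g`, so the lower bound on `s` suffices. Otherwise the Gram determinant of `x`, `f`,
  -- `g` is needed.
  by_cases hk : 0 ≤ N - a - b
  · have h1 : ‖f‖ ≤ ‖x - g‖ := by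
      exact le_of_sq_le_sq (by linarith) (norm_nonneg _)
    have h2 : ‖g‖ ≤ ‖x - f‖ := by
      exact le_of_sq_le_sq (by linarith) (norm_nonneg _)
    have h3 : ‖f‖ * ‖g‖ ≤ ‖x - g‖ * ‖x - f‖ :=
      mul_le_mul h1 h2 (norm_nonneg _) (norm_nonneg _)
    nlinarith [mul_le_mul_of_nonneg_left h3 hl0]
  · push Not at hk
    by_cases hf0 : f = 0
    · have : a = 0 := by rw [ha, hf0, inner_zero_left]
      have h4 : s = 0 := by rw [hs, hf0, inner_zero_left]
      nlinarith [sq_nonneg ‖x - g‖]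
    by_cases hg0 : g = 0
    · have : b = 0 := by rw [hb, hg0, inner_zero_left]
      have h4 : s = 0 := by rw [hs, hg0, inner_zero_right]
      nlinarith [sq_nonneg ‖x - f‖]
    have ha0 : 0 < a := by rw [← ha2]; positivity
    have hb0 : 0 < b := by rw [← hb2]; positivity
    have hs2 : s ^ 2 ≤ l ^ 2 * (a * b) := by
      calc s ^ 2 = |s| ^ 2 := (sq_abs s).symm
        _ ≤ (l * (‖f‖ * ‖g‖)) ^ 2 := by gcongr
        _ = _ := by rw [mul_pow, mul_pow, ha2, hb2]
    have hab : 0 < a * b := by positivity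
    have hdisc : 0 < a * b - s ^ 2 := by
      have : l ^ 2 * (a * b) < 1 * (a * b) := by gcongr; nlinarith
      linarith
    -- This is the Gram determinant of `x`, `f`, `g`. The vector tested below is `a * b - s ^ 2`
    -- times the component of `x` orthogonal to the span of `f` and `g`.
    have hdet : 0 ≤ N * (a * b - s ^ 2) - a ^ 2 * b - a * b ^ 2 + 2 * s * a * b := by
      have h := real_inner_self_nonneg
        (x := (a * b - s ^ 2) • x - (a * b - s * b) • f - (a * b - s * a) • g)
      simp only [inner_sub_left, inner_sub_right, inner_smul_left, inner_smul_right, hf, hg, hfx,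
        hgx, hgf, ← ha, ← hb, ← hN, ← hs, conj_trivial] at h
      have h' : 0 ≤ (a * b - s ^ 2) *
        (N * (a * b - s ^ 2) - a ^ 2 * b - a * b ^ 2 + 2 * s * a * b) := by
        refine h.trans_eq ?_; ring
      exact nonneg_of_mul_nonneg_right h' hdisc
    have hsq : (N - a - b + s) ^ 2 ≤ (l * (‖x - g‖ * ‖x - f‖)) ^ 2 := by
      rw [mul_pow, mul_pow, hp, hq]
      have hpq : 0 ≤ (N - b) * (N - a) := by rw [← hp, ← hq]; positivity
      -- By this identity and `N - a - b < 0`, the squared cosine of the complements is at most that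
      -- of `f` and `g`.
      have key : a * b * (N - a - b + s) ^ 2 - s ^ 2 * ((N - b) * (N - a)) =
        (N * (a * b - s ^ 2) - a ^ 2 * b - a * b ^ 2 + 2 * s * a * b) * (N - a - b) := by ring
      have h5 := mul_nonneg hdet (neg_nonneg.2 hk.le)
      have h6 := mul_le_mul_of_nonneg_right hs2 hpq
      refine le_of_mul_le_mul_left ?_ hab
      calc a * b * (N - a - b + s) ^ 2 ≤ s ^ 2 * ((N - b) * (N - a)) := by
            rw [← sub_nonpos, key]; rw [mul_neg] at h5; linarith
        _ ≤ _ := h6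
        _ = _ := by ring
    exact (abs_le.1 (abs_le_of_sq_le_sq hsq hrhs0)).1

/-- A homogeneous form of a quadratic inequality on two subspaces. -/
theorem abs_inner_le_of_two_mul_inner_le {U W : Submodule ℝ E} {l : ℝ}
    (h : ∀ f ∈ U, ∀ g ∈ W, 2 * ⟪f, g⟫ ≤ l * (‖f‖ ^ 2 + ‖g‖ ^ 2)) {f g : E} (hf : f ∈ U)
    (hg : g ∈ W) : |⟪f, g⟫| ≤ l * (‖f‖ * ‖g‖) := by
  have key : ∀ g ∈ W, ⟪f, g⟫ ≤ l * (‖f‖ * ‖g‖) := by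
    intro g hg
    by_cases hf0 : f = 0
    · simp [hf0]
    by_cases hg0 : g = 0
    · simp [hg0]
    -- Both vectors are rescaled to length `‖f‖ * ‖g‖`, where the arithmetic and geometric means of
    -- the squared norms agree.
    have h1 := h _ (U.smul_mem ‖g‖ hf) _ (W.smul_mem ‖f‖ hg)
    rw [inner_smul_left, inner_smul_right, norm_smul, norm_smul] at h1
    simp only [conj_trivial, norm_norm] at h1
    have hpos : 0 < ‖f‖ * ‖g‖ := by positivity
    refine le_of_mul_le_mul_left ?_ hpos
    nlinarith
  rw [abs_le]
  refine ⟨?_, key g hg⟩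
  have := key (-g) (W.neg_mem hg)
  rw [inner_neg_right, norm_neg] at this
  linarith

/-- A spectral gap for the sum of the complements of finitely many projections whose pairwise
angles are controlled by a positive definite matrix. -/
theorem exists_fixed_norm_sub_sq_le [CompleteSpace E] {ι : Type*} [Fintype ι]
    (P : ι → E →ₗ[ℝ] E) (hsymm : ∀ i, (P i).IsSymmetric) (hidem : ∀ i x, P i (P i x) = P i x)
    {A : Matrix ι ι ℝ} {l : ℝ} (hl : 0 < l)
    (hA : ∀ d : ι → ℝ, l * ∑ i, d i ^ 2 ≤ ∑ i, ∑ j, A i j * (d i * d j))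
    (hangle : ∀ i j x, A i j * (‖x - P i x‖ * ‖x - P j x‖) ≤ ⟪x - P i x, x - P j x⟫) (x : E) :
    ∃ z, (∀ i, P i z = z) ∧ l * ‖x - z‖ ^ 2 ≤ ∑ i, ‖x - P i x‖ ^ 2 := by
  have hPP : ∀ i x y, ⟪x - P i x, y⟫ = ⟪x - P i x, y - P i y⟫ := by
    intro i x y
    have h : ⟪x - P i x, P i y⟫ = 0 := by
      rw [inner_sub_left, hsymm i x (P i y), hidem, sub_self]
    rw [inner_sub_right, h, sub_zero]
  have hdecr : ∀ i x, ‖x - P i x‖ ≤ ‖x‖ := by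
    intro i x
    have h1 : ‖x - P i x‖ ^ 2 ≤ ‖x - P i x‖ * ‖x‖ := by
      rw [← real_inner_self_eq_norm_sq, ← hPP]; exact real_inner_le_norm _ _
    rcases (norm_nonneg (x - P i x)).eq_or_lt with h | h
    · rw [← h]; exact norm_nonneg _
    · nlinarith
  let Δ : E →ₗ[ℝ] E := ∑ i, (LinearMap.id - P i)
  have hΔ : ∀ x, Δ x = ∑ i, (x - P i x) := by
    intro x; simp [Δ, LinearMap.sum_apply]
  have hform : ∀ x y, ⟪Δ x, y⟫ = ∑ i, ⟪x - P i x, y - P i y⟫ := by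
    intro x y
    rw [hΔ, sum_inner]
    exact Finset.sum_congr rfl fun i _ => hPP i x y
  have hform' : ∀ x, ⟪Δ x, x⟫ = ∑ i, ‖x - P i x‖ ^ 2 := by
    intro x
    rw [hform]
    exact Finset.sum_congr rfl fun i _ => real_inner_self_eq_norm_sq _
  have hΔsymm : ∀ x y, ⟪Δ x, y⟫ = ⟪x, Δ y⟫ := by
    intro x y
    rw [hform, ← real_inner_comm, hform]
    exact Finset.sum_congr rfl fun i _ => real_inner_comm _ _
  -- This is Δ² ≥ lΔ: expand `‖Δ x‖ ^ 2` as a double sum, apply `hangle` termwise, then `hA` to the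
  -- numbers `‖x - P i x‖`.
  have h21 : ∀ x, l * ⟪Δ x, x⟫ ≤ ‖Δ x‖ ^ 2 := by
    intro x
    rw [hform', ← real_inner_self_eq_norm_sq]
    conv_rhs => rw [hΔ, sum_inner]
    refine (hA fun i => ‖x - P i x‖).trans (Finset.sum_le_sum fun i _ => ?_)
    rw [inner_sum]
    exact Finset.sum_le_sum fun j _ => hangle i j x
  have hcs : ∀ x y, ⟪Δ x, y⟫ ^ 2 ≤ ⟪Δ x, x⟫ * ⟪Δ y, y⟫ := by
    intro x y
    rw [hform', hform', hform]
    calc (∑ i, ⟪x - P i x, y - P i y⟫) ^ 2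
        ≤ (∑ i, ‖x - P i x‖ * ‖y - P i y‖) ^ 2 := by
          rw [← sq_abs]
          gcongr
          exact (Finset.abs_sum_le_sum_abs _ _).trans
            (Finset.sum_le_sum fun i _ => abs_real_inner_le_norm _ _)
      _ ≤ _ := Finset.sum_mul_sq_le_sq_mul_sq _ _ _
  -- Cauchy–Schwarz for the form of Δ, applied to `x` and `y = Δ x`, gives ‖y‖⁴ ≤ ⟨Δx,x⟩⟨Δy,y⟩; with
  -- Δ² ≥ lΔ this becomes the gap at `y`, without spectral theory.
  have hrange : ∀ y ∈ LinearMap.range Δ, l * ‖y‖ ^ 2 ≤ ∑ i, ‖y - P i y‖ ^ 2 := by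
    rintro _ ⟨x, rfl⟩
    rw [← hform']
    have h1 := hcs x (Δ x)
    rw [real_inner_self_eq_norm_sq] at h1
    have h2 := h21 x
    by_cases h0 : Δ x = 0
    · simp [h0]
    have hpos : 0 < ‖Δ x‖ ^ 2 := by positivity
    have h3 : 0 ≤ ⟪Δ (Δ x), Δ x⟫ := by rw [hform']; positivity
    refine le_of_mul_le_mul_left ?_ hpos
    nlinarith [mul_le_mul_of_nonneg_right h2 h3]
  let Q : ι → E →L[ℝ] E := fun i => (LinearMap.id - P i).mkContinuous 1 fun x => by
    simpa using hdecr i x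
  have hQ : ∀ i x, Q i x = x - P i x := fun i x => rfl
  have hclosure : ∀ y ∈ (LinearMap.range Δ).topologicalClosure,
      l * ‖y‖ ^ 2 ≤ ∑ i, ‖y - P i y‖ ^ 2 := by
    intro y hy
    have hcl : IsClosed {y : E | l * ‖y‖ ^ 2 ≤ ∑ i, ‖Q i y‖ ^ 2} :=
      isClosed_le (by fun_prop) (by fun_prop)
    exact closure_minimal (s := (LinearMap.range Δ : Set E)) (fun y hy => hrange y hy) hcl hy
  have hcompl := (Submodule.isClosed_topologicalClosure (LinearMap.range Δ)).completeSpace_coe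
  -- The orthogonal complement of the range of the symmetric map Δ is its kernel, and there every
  -- `‖z - P i z‖` vanishes because their squares sum to ⟨Δz,z⟩.
  obtain ⟨y, hy, z, hz, hxyz⟩ :=
    (LinearMap.range Δ).topologicalClosure.exists_add_mem_mem_orthogonal x
  have hz0 : ∀ i, P i z = z := by
    have h1 : Δ z = 0 := by
      rw [← inner_self_eq_zero (𝕜 := ℝ), hΔsymm, real_inner_comm]
      exact hz _ (Submodule.le_topologicalClosure _ ⟨Δ z, rfl⟩)
    have h2 := hform' z
    rw [h1, inner_zero_left, eq_comm, Finset.sum_eq_zero_iff_of_nonneg (fun _ _ => by positivity)]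
      at h2
    intro i
    have h3 := h2 i (Finset.mem_univ i)
    rw [sq_eq_zero_iff, norm_eq_zero, sub_eq_zero] at h3
    exact h3.symm
  refine ⟨z, hz0, ?_⟩
  have hxz : x - z = y := by rw [hxyz]; abel
  rw [hxz]
  refine (hclosure y hy).trans_eq (Finset.sum_congr rfl fun i _ => ?_)
  rw [← hxz, map_sub, hz0]
  congr 2; abel

end Projections

/-! ### Equivariant functions and averaging over invariant partitions -/

section Partitions

/-- A partition of `C` into finite classes that is invariant under the action of `S`. -/
structure InvPartition (S C : Type*) [Group S] [MulAction S C] where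
  /-- The class of an element. -/
  cls : C → Finset C
  self_mem : ∀ a, a ∈ cls a
  cls_eq : ∀ {a b}, b ∈ cls a → cls b = cls a
  smul_mem : ∀ (g : S) {a b}, b ∈ cls a → g • b ∈ cls (g • a)

/-- A finite set of orbit representatives with positive weights. -/
structure WeightedDomain (S C : Type*) [Group S] [MulAction S C] where
  /-- The representatives. -/
  reps : Finset C
  /-- The weights. -/
  weight : C → ℝ
  weight_pos : ∀ a, 0 < weight a
  exists_smul : ∀ c, ∃ d ∈ reps, ∃ g : S, g • d = c
  unique : ∀ d ∈ reps, ∀ d' ∈ reps, ∀ g : S, g • d = d' → d = d'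

variable {S C : Type*} [Group S] [MulAction S C]

namespace InvPartition

variable (p : InvPartition S C) {F : Type*} [AddCommGroup F] [Module ℝ F]

theorem mem_symm {a b : C} (h : b ∈ p.cls a) : a ∈ p.cls b := by
  rw [p.cls_eq h]; exact p.self_mem a

theorem smul_mem_iff (g : S) {a b : C} : g • b ∈ p.cls (g • a) ↔ b ∈ p.cls a := by
  refine ⟨fun h => ?_, p.smul_mem g⟩
  have := p.smul_mem g⁻¹ h
  rwa [inv_smul_smul, inv_smul_smul] at this

theorem map_cls (g : S) (a : C) :
    (p.cls a).map (MulAction.toPerm g).toEmbedding = p.cls (g • a) := by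
  ext b
  simp only [Finset.mem_map_equiv]
  rw [← p.smul_mem_iff g]
  simp

theorem card_cls_smul (g : S) (a : C) : (p.cls (g • a)).card = (p.cls a).card := by
  rw [← p.map_cls, Finset.card_map]

theorem sum_cls_smul {M : Type*} [AddCommMonoid M] (g : S) (a : C) (f : C → M) :
    ∑ b ∈ p.cls (g • a), f b = ∑ b ∈ p.cls a, f (g • b) := by
  rw [← p.map_cls, Finset.sum_map]; rfl

theorem card_cls_pos (a : C) : (0 : ℝ) < (p.cls a).card := by
  exact_mod_cast Finset.card_pos.2 ⟨a, p.self_mem a⟩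

/-- The average of a function over the classes. -/
noncomputable def avg (f : C → F) (a : C) : F :=
  ((p.cls a).card : ℝ)⁻¹ • ∑ b ∈ p.cls a, f b

theorem avg_of_mem (f : C → F) {a b : C} (h : b ∈ p.cls a) : p.avg f b = p.avg f a := by
  rw [avg, avg, p.cls_eq h]

theorem avg_of_const {f : C → F} {a : C} (h : ∀ b ∈ p.cls a, f b = f a) : p.avg f a = f a := by
  rw [avg, Finset.sum_congr rfl h, Finset.sum_const, ← Nat.cast_smul_eq_nsmul ℝ,
    inv_smul_smul₀ (p.card_cls_pos a).ne']

theorem sum_eq_card_smul_avg (f : C → F) (a : C) :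
    ∑ b ∈ p.cls a, f b = ((p.cls a).card : ℝ) • p.avg f a := by
  rw [avg, smul_inv_smul₀ (p.card_cls_pos a).ne']

/-- The mean minimizes the sum of the squared distances to the values of a function. -/
theorem avg_norm_sub_sq_le {H : Type*} [NormedAddCommGroup H] [InnerProductSpace ℝ H]
    (f : C → H) (x : H) (a : C) :
    p.avg (fun c => ‖f c - p.avg f c‖ ^ 2) a ≤ p.avg (fun c => ‖f c - x‖ ^ 2) a := by
  unfold avg
  simp only [smul_eq_mul]
  refine mul_le_mul_of_nonneg_left ?_ (inv_nonneg.2 (p.card_cls_pos a).le)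
  obtain ⟨m, hm⟩ : ∃ m, m = p.avg f a := ⟨_, rfl⟩
  have h1 : ∑ b ∈ p.cls a, ‖f b - p.avg f b‖ ^ 2 = ∑ b ∈ p.cls a, ‖f b - m‖ ^ 2 :=
    Finset.sum_congr rfl fun b hb => by rw [p.avg_of_mem f hb, hm]
  have h2 : ∑ b ∈ p.cls a, inner ℝ (f b - m) (m - x) = 0 := by
    rw [← sum_inner, Finset.sum_sub_distrib, p.sum_eq_card_smul_avg, Finset.sum_const,
      ← Nat.cast_smul_eq_nsmul ℝ, hm, sub_self, inner_zero_left]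
  have h3 : ∑ b ∈ p.cls a, ‖f b - x‖ ^ 2 =
      ∑ b ∈ p.cls a, ‖f b - m‖ ^ 2 + ∑ _b ∈ p.cls a, ‖m - x‖ ^ 2 := by
    rw [← add_zero (∑ b ∈ p.cls a, ‖f b - m‖ ^ 2), ← mul_zero (2 : ℝ), ← h2, Finset.mul_sum,
      ← Finset.sum_add_distrib, ← Finset.sum_add_distrib]
    refine Finset.sum_congr rfl fun b _ => ?_
    rw [← norm_add_sq_real, sub_add_sub_cancel]
  change ∑ b ∈ p.cls a, ‖f b - p.avg f b‖ ^ 2 ≤ _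
  rw [h1, h3]
  exact le_add_of_nonneg_right (Finset.sum_nonneg fun _ _ => by positivity)

end InvPartition

/-! ### Integration over orbit representatives and mass transport -/

namespace WeightedDomain

variable (W : WeightedDomain S C) {F : Type*} [AddCommGroup F] [Module ℝ F]

/-- The weighted sum over orbit representatives. -/
def integral (f : C → F) : F := ∑ d ∈ W.reps, W.weight d • f d

open Classical in
/-- Mass transport along the partition `p`. -/
def Balanced (p : InvPartition S C) : Prop :=
  ∀ a b, W.weight a * ((p.cls a).filter (· ∈ MulAction.orbit S b)).card =
    W.weight b * ((p.cls b).filter (· ∈ MulAction.orbit S a)).card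

/-- An invariant function is determined on each orbit by its value at the representative, so only
the number of points of `s` in each orbit matters. -/
theorem sum_card_filter (s : Finset C) (f : C → F) (hf : ∀ (g : S) c, f (g • c) = f c)
    [∀ b : C, DecidablePred (· ∈ MulAction.orbit S b)] :
    ∑ c ∈ s, f c = ∑ b ∈ W.reps, ((s.filter (· ∈ MulAction.orbit S b)).card : ℝ) • f b := by
  classical
  choose r hr g hg using W.exists_smul
  rw [← Finset.sum_fiberwise_of_maps_to (g := r) (t := W.reps) (fun c _ => hr c)]
  refine Finset.sum_congr rfl fun b hb => ?_
  have : s.filter (· ∈ MulAction.orbit S b) = s.filter (fun c => r c = b) := by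
    refine Finset.filter_congr fun c _ => ⟨?_, ?_⟩
    · rintro ⟨h, hh⟩
      refine W.unique _ (hr c) _ hb (h⁻¹ * g c) ?_
      rw [mul_smul, hg, ← hh]
      exact inv_smul_smul h b
    · rintro rfl
      exact ⟨g c, hg c⟩
  rw [this, Nat.cast_smul_eq_nsmul, ← Finset.sum_const]
  refine Finset.sum_congr rfl fun c hc => ?_
  rw [← (Finset.mem_filter.1 hc).2]
  conv_lhs => rw [← hg c]
  rw [hf]

/-- Sorting each average by orbits gives a double sum over representatives in which `Balanced`
exchanges the two points. After the exchange the counts add up to the size of the class of `b`,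
which cancels the normalization. -/
theorem integral_avg {p : InvPartition S C} (hp : W.Balanced p) (f : C → F)
    (hf : ∀ (g : S) c, f (g • c) = f c) : W.integral (p.avg f) = W.integral f := by
  classical
  have h1 : W.integral (p.avg f) = ∑ a ∈ W.reps, ∑ b ∈ W.reps,
      (W.weight b * ((p.cls b).filter (· ∈ MulAction.orbit S a)).card *
        ((p.cls b).card : ℝ)⁻¹) • f b := by
    refine Finset.sum_congr rfl fun a _ => ?_
    rw [InvPartition.avg, W.sum_card_filter _ f hf, Finset.smul_sum, Finset.smul_sum]
    refine Finset.sum_congr rfl fun b _ => ?_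
    rw [smul_smul, smul_smul, ← hp a b]
    -- If the class of `a` meets the orbit of `b`, it is a translate of the class of `b`, so the two
    -- normalizations agree.
    by_cases h0 : ((p.cls a).filter (· ∈ MulAction.orbit S b)).card = 0
    · rw [h0]; simp
    · obtain ⟨c, hc⟩ := Finset.card_ne_zero.1 h0
      obtain ⟨hc, g, rfl⟩ := Finset.mem_filter.1 hc
      have h2 : (p.cls b).card = (p.cls a).card := by
        rw [← p.cls_eq hc]; exact (p.card_cls_smul g b).symm
      rw [h2]; congr 1; ring
  rw [h1, Finset.sum_comm]
  refine Finset.sum_congr rfl fun b _ => ?_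
  rw [← Finset.sum_smul, ← Finset.sum_mul, ← Finset.mul_sum]
  have h3 : ∑ a ∈ W.reps, (((p.cls b).filter (· ∈ MulAction.orbit S a)).card : ℝ) =
      (p.cls b).card := by
    have := W.sum_card_filter (p.cls b) (fun _ => (1 : ℝ)) fun _ _ => rfl
    simpa using this.symm
  rw [h3, mul_inv_cancel_right₀ (p.card_cls_pos b).ne']

end WeightedDomain

end Partitions

/-! ### The Hilbert space of equivariant functions and its averaging projections -/

section Equivariant

variable {S C : Type*} [Group S] [MulAction S C] {H : Type*} [NormedAddCommGroup H]
  [InnerProductSpace ℝ H]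

/-- The equivariant functions on `C`. -/
def equivariantSubmodule (C : Type*) [MulAction S C] (π : S →* (H ≃ₗᵢ[ℝ] H)) :
    Submodule ℝ (C → H) where
  carrier := {φ | ∀ (g : S) c, φ (g • c) = π g (φ c)}
  add_mem' hφ hψ g c := by simp [hφ g c, hψ g c]
  zero_mem' g c := by simp
  smul_mem' r φ hφ g c := by simp [hφ g c]

/-- The equivariant functions, with the inner product given by a weighted domain. -/
def EquivFun (_W : WeightedDomain S C) (π : S →* (H ≃ₗᵢ[ℝ] H)) : Type _ :=
  equivariantSubmodule C π

namespace EquivFun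

variable (W : WeightedDomain S C) (π : S →* (H ≃ₗᵢ[ℝ] H))

noncomputable instance : AddCommGroup (EquivFun W π) :=
  inferInstanceAs (AddCommGroup (equivariantSubmodule C π))

noncomputable instance : Module ℝ (EquivFun W π) :=
  inferInstanceAs (Module ℝ (equivariantSubmodule C π))

variable {W π}

/-- The underlying function. -/
def toFun (φ : EquivFun W π) : C → H :=
  Subtype.val (p := fun φ => φ ∈ equivariantSubmodule C π) φ

instance : CoeFun (EquivFun W π) fun _ => C → H := ⟨toFun⟩

/-- An equivariant function from a function. -/
def ofFun (φ : C → H) (h : ∀ (g : S) c, φ (g • c) = π g (φ c)) : EquivFun W π :=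
  Subtype.mk (p := fun φ => φ ∈ equivariantSubmodule C π) φ h

@[simp] theorem ofFun_apply (φ : C → H) (h : ∀ (g : S) c, φ (g • c) = π g (φ c)) (c : C) :
    (ofFun φ h : EquivFun W π) c = φ c := rfl

theorem smul_apply' (φ : EquivFun W π) (g : S) (c : C) : φ (g • c) = π g (φ c) :=
  Subtype.property (p := fun φ => φ ∈ equivariantSubmodule C π) φ g c

@[simp] theorem add_apply (φ ψ : EquivFun W π) (c : C) : (φ + ψ) c = φ c + ψ c := rfl
@[simp] theorem sub_apply (φ ψ : EquivFun W π) (c : C) : (φ - ψ) c = φ c - ψ c := rfl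
@[simp] theorem smul_apply (r : ℝ) (φ : EquivFun W π) (c : C) : (r • φ) c = r • φ c := rfl
@[simp] theorem zero_apply (c : C) : (0 : EquivFun W π) c = 0 := rfl

theorem ext {φ ψ : EquivFun W π} (h : ∀ c, φ c = ψ c) : φ = ψ := Subtype.ext (funext h)

variable (W π)

/-- The inner product of equivariant functions. -/
@[reducible]
noncomputable def core : InnerProductSpace.Core ℝ (EquivFun W π) where
  inner φ ψ := W.integral fun c => inner ℝ (φ c) (ψ c)
  conj_inner_symm φ ψ := by
    simp only [conj_trivial]
    exact Finset.sum_congr rfl fun d _ => congrArg _ (real_inner_comm _ _)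
  re_inner_nonneg φ := by
    refine Finset.sum_nonneg fun d _ => ?_
    exact mul_nonneg (W.weight_pos d).le real_inner_self_nonneg
  add_left φ ψ χ := by
    simp [WeightedDomain.integral, inner_add_left, mul_add, Finset.sum_add_distrib]
  smul_left φ ψ r := by
    simp only [WeightedDomain.integral, smul_apply, inner_smul_left, smul_eq_mul, Finset.mul_sum]
    exact Finset.sum_congr rfl fun d _ => by ring
  definite φ h := by
    have h1 := (Finset.sum_eq_zero_iff_of_nonneg fun d _ =>
      mul_nonneg (W.weight_pos d).le real_inner_self_nonneg).1 h
    refine ext fun c => ?_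
    obtain ⟨d, hd, g, rfl⟩ := W.exists_smul c
    have h2 := (mul_eq_zero.1 (h1 d hd)).resolve_left (W.weight_pos d).ne'
    rw [smul_apply', inner_self_eq_zero.1 h2, map_zero, zero_apply]

noncomputable instance : NormedAddCommGroup (EquivFun W π) :=
  (core W π).toNormedAddCommGroup

noncomputable instance : InnerProductSpace ℝ (EquivFun W π) :=
  InnerProductSpace.ofCore (core W π).toCore

variable {W π}

theorem inner_def (φ ψ : EquivFun W π) :
    inner ℝ φ ψ = W.integral fun c => inner ℝ (φ c) (ψ c) := rfl

theorem norm_sq_def (φ : EquivFun W π) : ‖φ‖ ^ 2 = W.integral fun c => ‖φ c‖ ^ 2 := by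
  rw [← real_inner_self_eq_norm_sq, inner_def]
  simp only [real_inner_self_eq_norm_sq]

theorem weight_mul_norm_sq_le (φ : EquivFun W π) {d : C} (hd : d ∈ W.reps) :
    W.weight d * ‖φ d‖ ^ 2 ≤ ‖φ‖ ^ 2 := by
  rw [norm_sq_def]
  exact Finset.single_le_sum (f := fun d => W.weight d • ‖φ d‖ ^ 2)
    (fun d _ => mul_nonneg (W.weight_pos d).le (by positivity)) hd

/-- Evaluation at a representative is controlled by its positive weight, and any other value is the
image of such a value under an isometry. -/
theorem norm_apply_le (W : WeightedDomain S C) (π : S →* (H ≃ₗᵢ[ℝ] H)) (c : C) :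
    ∃ k, 0 < k ∧ ∀ φ : EquivFun W π, ‖φ c‖ ≤ k * ‖φ‖ := by
  obtain ⟨d, hd, g, rfl⟩ := W.exists_smul c
  have hw := W.weight_pos d
  refine ⟨√(W.weight d)⁻¹, by positivity, fun φ => ?_⟩
  rw [smul_apply', LinearIsometryEquiv.norm_map]
  refine le_of_sq_le_sq ?_ (by positivity)
  rw [mul_pow, Real.sq_sqrt (by positivity), ← div_eq_inv_mul, le_div_iff₀' hw]
  exact weight_mul_norm_sq_le φ hd

/-- Evaluations are bounded, so Cauchy sequences converge pointwise to an equivariant limit; the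
norm sees only finitely many points, so the convergence is also in norm. -/
instance [CompleteSpace H] : CompleteSpace (EquivFun W π) := by
  refine Metric.complete_of_cauchySeq_tendsto fun u hu => ?_
  have hc : ∀ c, CauchySeq fun k => u k c := by
    intro c
    obtain ⟨k, hk, h⟩ := norm_apply_le W π c
    rw [Metric.cauchySeq_iff] at hu ⊢
    intro ε hε
    obtain ⟨N, hN⟩ := hu (ε / k) (by positivity)
    refine ⟨N, fun m hm m' hm' => ?_⟩
    have h1 := hN m hm m' hm'
    rw [dist_eq_norm] at h1 ⊢
    rw [lt_div_iff₀' hk] at h1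
    exact (h (u m - u m')).trans_lt h1
  choose φ hφ using fun c => cauchySeq_tendsto_of_complete (hc c)
  have hφe : ∀ (g : S) c, φ (g • c) = π g (φ c) := by
    intro g c
    refine tendsto_nhds_unique (hφ (g • c)) ?_
    simp only [smul_apply']
    exact ((π g).continuous.tendsto _).comp (hφ c)
  refine ⟨ofFun φ hφe, ?_⟩
  rw [tendsto_iff_norm_sub_tendsto_zero]
  have h2 : Filter.Tendsto (fun k => ‖u k - ofFun φ hφe‖ ^ 2) Filter.atTop
      (nhds 0) := by
    simp only [norm_sq_def]
    have : (0 : ℝ) = ∑ d ∈ W.reps, W.weight d • (0 : ℝ) ^ 2 := by simp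
    rw [this]
    refine tendsto_finsetSum _ fun d _ => Filter.Tendsto.const_smul (Filter.Tendsto.pow ?_ 2) _
    exact tendsto_iff_norm_sub_tendsto_zero.1 (hφ d)
  have h3 := h2.sqrt
  simpa [Real.sqrt_sq] using h3

/-- Averaging of equivariant functions over the classes of an invariant partition. -/
noncomputable def avgMap (W : WeightedDomain S C) (π : S →* (H ≃ₗᵢ[ℝ] H))
    (p : InvPartition S C) : EquivFun W π →ₗ[ℝ] EquivFun W π where
  toFun φ := ofFun (p.avg φ) fun g c => by
    simp only [InvPartition.avg, p.card_cls_smul, p.sum_cls_smul, smul_apply', map_smul, map_sum]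
  map_add' φ ψ := ext fun c => by
    simp only [InvPartition.avg, add_apply, Finset.sum_add_distrib, smul_add, ofFun_apply]
  map_smul' r φ := ext fun c => by
    simp only [InvPartition.avg, smul_apply, ← Finset.smul_sum, smul_comm r, ofFun_apply,
      RingHom.id_apply]

theorem avgMap_apply (p : InvPartition S C) (φ : EquivFun W π) (c : C) :
    avgMap W π p φ c = p.avg φ c := rfl

theorem avgMap_eq_self {p : InvPartition S C} {φ : EquivFun W π}
    (h : ∀ a, ∀ b ∈ p.cls a, φ b = φ a) : avgMap W π p φ = φ :=
  ext fun c => p.avg_of_const (h c)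

theorem avgMap_of_mem (p : InvPartition S C) (φ : EquivFun W π) {a b : C} (h : b ∈ p.cls a) :
    avgMap W π p φ b = avgMap W π p φ a := p.avg_of_mem _ h

theorem avgMap_idem (p : InvPartition S C) (φ : EquivFun W π) :
    avgMap W π p (avgMap W π p φ) = avgMap W π p φ :=
  avgMap_eq_self fun _ _ hb => avgMap_of_mem p φ hb

/-- The integrand is invariant, so it may be averaged over classes; on a class the first argument is
constant and the average moves to the second. -/
theorem inner_avgMap {p : InvPartition S C} (hp : W.Balanced p) (φ ψ : EquivFun W π) :
    inner ℝ (avgMap W π p φ) ψ = inner ℝ (avgMap W π p φ) (avgMap W π p ψ) := by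
  rw [inner_def, inner_def, ← W.integral_avg hp]
  · refine Finset.sum_congr rfl fun d _ => ?_
    congr 1
    simp only [InvPartition.avg, avgMap_apply _ ψ, inner_smul_right, inner_sum, smul_eq_mul]
    congr 1
    exact Finset.sum_congr rfl fun b hb => by rw [avgMap_of_mem p φ hb]
  · intro g c
    rw [smul_apply', smul_apply', LinearIsometryEquiv.inner_map_map]

theorem avgMap_isSymmetric {p : InvPartition S C} (hp : W.Balanced p) :
    (avgMap W π p).IsSymmetric := by
  intro φ ψ
  rw [inner_avgMap hp, real_inner_comm, ← inner_avgMap hp, real_inner_comm]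

/-- Averaging over a coarser partition absorbs averaging over a finer one. -/
theorem avgMap_avgMap {p q : InvPartition S C} (hp : W.Balanced p) (hq : W.Balanced q)
    (hpq : ∀ a, p.cls a ⊆ q.cls a) (φ : EquivFun W π) :
    avgMap W π q (avgMap W π p φ) = avgMap W π q φ := by
  -- After moving both averages to `ψ`, the claim is that the average over the coarser `q` is
  -- constant on the classes of `p`.
  refine ext_inner_right ℝ fun ψ => ?_
  rw [avgMap_isSymmetric hq, avgMap_isSymmetric hp, avgMap_isSymmetric hq]
  congr 1
  exact avgMap_eq_self fun a b hb => avgMap_of_mem q ψ (hpq a hb)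

end EquivFun

end Equivariant

/-! ### Almost invariant vectors -/

section AlmostInvariant

variable {S C : Type*} [Group S] [MulAction S C] {H : Type*} [NormedAddCommGroup H]
  [InnerProductSpace ℝ H]

/-- A vector fixed by the subgroup `T` that is a limit of convex combinations of the `T`-translates
of `x`. -/
theorem exists_fixed_mem_convexHull [CompleteSpace H] (π : S →* (H ≃ₗᵢ[ℝ] H)) (T : Subgroup S)
    (x : H) : ∃ y, (∀ g ∈ T, π g y = y) ∧
      ∀ (g : S) (z : H) (δ : ℝ), (∀ s ∈ T, ‖π (g * s) x - z‖ ≤ δ) → ‖π g y - z‖ ≤ δ := by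
  let O : Set H := {v | ∃ s ∈ T, π s x = v}
  let K : Set H := closedConvexHull ℝ O
  have hOK : O ⊆ K := subset_closedConvexHull
  have hK : IsClosed K := isClosed_closedConvexHull
  have hKc : Convex ℝ K := convex_closedConvexHull
  have hmin : ∀ t : Set H, O ⊆ t → Convex ℝ t → IsClosed t → K ⊆ t :=
    fun t h1 h2 h3 => closedConvexHull_min h1 h2 h3
  -- The point of least norm in the closed convex hull of the orbit is fixed, because the isometries
  -- of `T` preserve the hull and the norm.
  obtain ⟨y, hy, hymin⟩ := exists_norm_eq_iInf_of_complete_convex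
    ⟨x, hOK ⟨1, T.one_mem, by simp⟩⟩ hK.isComplete hKc 0
  rw [norm_eq_iInf_iff_real_inner_le_zero hKc hy] at hymin
  refine ⟨y, fun g hg => ?_, fun g z δ h => ?_⟩
  · have hgK : π g y ∈ K := by
      have : K ⊆ (π g) ⁻¹' K := by
        refine hmin _ ?_ (hKc.is_linear_preimage (π g).toLinearEquiv.toLinearMap.isLinear)
          (hK.preimage (π g).continuous)
        rintro _ ⟨s, hs, rfl⟩
        exact hOK ⟨g * s, T.mul_mem hg hs, by rw [map_mul]; rfl⟩
      exact this hy
    have h1 := hymin _ hgK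
    rw [zero_sub, inner_neg_left, inner_sub_right, real_inner_self_eq_norm_sq] at h1
    have h2 : ‖y - π g y‖ ^ 2 ≤ 0 := by
      rw [norm_sub_sq_real, LinearIsometryEquiv.norm_map]; linarith
    have h3 := pow_eq_zero_iff two_ne_zero |>.1 (le_antisymm h2 (by positivity))
    exact (sub_eq_zero.1 (norm_eq_zero.1 h3)).symm
  · have : K ⊆ (π g) ⁻¹' Metric.closedBall z δ := by
      refine hmin _ ?_ ((convex_closedBall z δ).is_linear_preimage
        (π g).toLinearEquiv.toLinearMap.isLinear)
        (Metric.isClosed_closedBall.preimage (π g).continuous)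
      rintro _ ⟨s, hs, rfl⟩
      simp only [Set.mem_preimage, mem_closedBall_iff_norm]
      have := h s hs
      rwa [map_mul] at this
    exact mem_closedBall_iff_norm.1 (this hy)

/-- The angle inequality between averaging operators, from the inequality on each class of the
coarser partition. -/
theorem EquivFun.neg_mul_le_inner_sub_avgMap {W : WeightedDomain S C} {π : S →* (H ≃ₗᵢ[ℝ] H)}
    {p p' q : InvPartition S C} (hp : W.Balanced p) (hp' : W.Balanced p') (hq : W.Balanced q)
    (hpq : ∀ a, p.cls a ⊆ q.cls a) (hpq' : ∀ a, p'.cls a ⊆ q.cls a) {l : ℝ} (hl0 : 0 ≤ l)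
    (hl1 : l < 1)
    (hlocal : ∀ f g : C → H, (∀ a, ∀ b ∈ p.cls a, f b = f a) → (∀ a, ∀ b ∈ p'.cls a, g b = g a) →
      (∀ a, ∑ b ∈ q.cls a, f b = 0) → (∀ a, ∑ b ∈ q.cls a, g b = 0) → ∀ a,
      2 * ∑ b ∈ q.cls a, inner ℝ (f b) (g b) ≤ l * ∑ b ∈ q.cls a, (‖f b‖ ^ 2 + ‖g b‖ ^ 2))
    (φ : EquivFun W π) :
    -l * (‖φ - avgMap W π p φ‖ * ‖φ - avgMap W π p' φ‖) ≤
      inner ℝ (φ - avgMap W π p φ) (φ - avgMap W π p' φ) := by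
  -- Functions constant on the classes of `r` with mean zero on the classes of `q`: the part common
  -- to the two images has to be removed before measuring their angle.
  let V : InvPartition S C → Submodule ℝ (EquivFun W π) := fun r =>
    LinearMap.ker (LinearMap.id - avgMap W π r) ⊓ LinearMap.ker (avgMap W π q)
  have hV : ∀ r φ, φ ∈ V r ↔ avgMap W π r φ = φ ∧ avgMap W π q φ = 0 := by
    intro r φ
    simp only [V, Submodule.mem_inf, LinearMap.mem_ker, LinearMap.sub_apply, LinearMap.id_apply,
      sub_eq_zero]
    rw [eq_comm]
  have hconst : ∀ r, ∀ φ ∈ V r, ∀ a, ∀ b ∈ r.cls a, φ b = φ a := by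
    intro r φ hφ a b hb
    rw [← ((hV r φ).1 hφ).1]
    exact avgMap_of_mem r φ hb
  have hzero : ∀ r, ∀ φ ∈ V r, ∀ a, ∑ b ∈ q.cls a, φ b = 0 := by
    intro r φ hφ a
    rw [q.sum_eq_card_smul_avg, ← avgMap_apply, ((hV r φ).1 hφ).2, zero_apply, smul_zero]
  have hquad : ∀ f ∈ V p, ∀ g ∈ V p', 2 * inner ℝ f g ≤ l * (‖f‖ ^ 2 + ‖g‖ ^ 2) := by
    intro f hf g hg
    rw [norm_sq_def, norm_sq_def, inner_def, ← W.integral_avg hq fun c => inner ℝ (f c) (g c),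
      ← W.integral_avg hq fun c => ‖f c‖ ^ 2, ← W.integral_avg hq fun c => ‖g c‖ ^ 2]
    · simp only [WeightedDomain.integral, Finset.mul_sum, ← Finset.sum_add_distrib]
      refine Finset.sum_le_sum fun d _ => ?_
      have h := hlocal f g (hconst p f hf) (hconst p' g hg) (hzero p f hf) (hzero p' g hg) d
      rw [Finset.sum_add_distrib] at h
      have hc : 0 ≤ W.weight d * ((q.cls d).card : ℝ)⁻¹ :=
        mul_nonneg (W.weight_pos d).le (inv_nonneg.2 (q.card_cls_pos d).le)
      have h' := mul_le_mul_of_nonneg_left h hc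
      simp only [InvPartition.avg, smul_eq_mul]
      nlinarith
    · intro s c; rw [smul_apply', LinearIsometryEquiv.norm_map]
    · intro s c; rw [smul_apply', LinearIsometryEquiv.norm_map]
    · intro s c; rw [smul_apply', smul_apply', LinearIsometryEquiv.inner_map_map]
  have hmem : ∀ r : InvPartition S C, W.Balanced r → (∀ a, r.cls a ⊆ q.cls a) →
      avgMap W π r (φ - avgMap W π q φ) ∈ V r := by
    intro r hr hrq
    rw [hV, avgMap_avgMap hr hq hrq, avgMap_idem, map_sub (avgMap W π q), avgMap_idem, sub_self]
    exact ⟨rfl, rfl⟩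
  -- Averages over `q` are fixed by the averages over finer partitions, so subtracting them from `φ`
  -- does not change the complements.
  have hcompl : ∀ r : InvPartition S C, (∀ a, r.cls a ⊆ q.cls a) →
      φ - avgMap W π r φ = (φ - avgMap W π q φ) - avgMap W π r (φ - avgMap W π q φ) := by
    intro r hrq
    have : avgMap W π r (avgMap W π q φ) = avgMap W π q φ :=
      avgMap_eq_self fun a b hb => avgMap_of_mem q φ (hrq a hb)
    rw [map_sub, this]; abel
  have hpair := abs_inner_le_of_two_mul_inner_le hquad (hmem p hp hpq) (hmem p' hp' hpq')
  rw [hcompl p hpq, hcompl p' hpq', neg_mul]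
  refine neg_mul_le_inner_sub_sub hl0 hl1 ?_ ?_ ?_
  · rw [real_inner_comm, inner_avgMap hp']
  · rw [real_inner_comm, inner_avgMap hp]
  · rw [real_inner_comm, mul_comm ‖avgMap W π p' _‖]
    exact hpair

/-- If the partitions have small angles and connect `C`, an almost invariant vector is close to an
invariant vector. -/
theorem exists_invariant_norm_sub_le [CompleteSpace H] (π : S →* (H ≃ₗᵢ[ℝ] H))
    (W : WeightedDomain S C) (hne : W.reps.Nonempty) {ι : Type*} [Fintype ι] [Nonempty ι]
    (p : ι → InvPartition S C) (q : ι → ι → InvPartition S C) (hp : ∀ i, W.Balanced (p i))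
    (hq : ∀ i j, i ≠ j → W.Balanced (q i j))
    (hpq : ∀ i j, i ≠ j → ∀ a, (p i).cls a ⊆ (q i j).cls a)
    (hpq' : ∀ i j, i ≠ j → ∀ a, (p j).cls a ⊆ (q i j).cls a)
    {A : Matrix ι ι ℝ} {l : ℝ} (hl : 0 < l)
    (hA : ∀ d : ι → ℝ, l * ∑ i, d i ^ 2 ≤ ∑ i, ∑ j, A i j * (d i * d j))
    (hdiag : ∀ i, A i i = 1) (hoff : ∀ i j, i ≠ j → 0 ≤ -A i j ∧ -A i j < 1)
    (hlocal : ∀ i j, i ≠ j → ∀ f g : C → H, (∀ a, ∀ b ∈ (p i).cls a, f b = f a) →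
      (∀ a, ∀ b ∈ (p j).cls a, g b = g a) →
      (∀ a, ∑ b ∈ (q i j).cls a, f b = 0) → (∀ a, ∑ b ∈ (q i j).cls a, g b = 0) → ∀ a,
      2 * ∑ b ∈ (q i j).cls a, inner ℝ (f b) (g b) ≤
        -A i j * ∑ b ∈ (q i j).cls a, (‖f b‖ ^ 2 + ‖g b‖ ^ 2))
    (hconn : ∀ φ : C → H, (∀ i a, ∀ b ∈ (p i).cls a, φ b = φ a) → ∀ a b, φ a = φ b)
    {x : H} {δ : ℝ} (hδ : ∀ d ∈ W.reps, ∀ i, ∀ d' ∈ W.reps, ∀ g : S, g • d' ∈ (p i).cls d →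
      ‖π g x - x‖ ≤ δ) :
    ∃ z, (∀ g, π g z = z) ∧ ‖x - z‖ ≤ δ * (1 + √(Fintype.card ι / l)) := by
  classical
  obtain ⟨i₀⟩ := ‹Nonempty ι›
  obtain ⟨d₀, hd₀⟩ := hne
  have hδ0 : 0 ≤ δ := by
    have := hδ d₀ hd₀ i₀ d₀ hd₀ 1 (by rw [one_smul]; exact (p i₀).self_mem d₀)
    exact (norm_nonneg _).trans this
  -- Replacing `x` by a vector fixed by the stabilizer of `d` makes the prescription φ(gd) = π(g)y_d
  -- independent of `g`.
  choose y hyfix hyball using fun d : C => exists_fixed_mem_convexHull π (MulAction.stabilizer S d) x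
  choose r hr γ hγ using W.exists_smul
  have hval : ∀ d ∈ W.reps, ∀ g : S, π (γ (g • d)) (y (r (g • d))) = π g (y d) := by
    intro d hd g
    have h1 : r (g • d) = d := by
      refine W.unique _ (hr _) d hd (g⁻¹ * γ (g • d)) ?_
      rw [mul_smul, hγ, inv_smul_smul]
    have h2 : γ (g • d) • d = g • d := by
      have := hγ (g • d)
      rwa [h1] at this
    rw [h1]
    have h3 : π (g⁻¹ * γ (g • d)) (y d) = y d := by
      apply hyfix
      rw [MulAction.mem_stabilizer_iff, mul_smul, h2, inv_smul_smul]
    have h4 : γ (g • d) = g * (g⁻¹ * γ (g • d)) := by group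
    rw [h4, map_mul]
    exact congrArg (π g) h3
  let φ : EquivFun W π := EquivFun.ofFun (fun c => π (γ c) (y (r c))) fun g c => by
    have h1 := hval (r c) (hr c) (g * γ c)
    rw [mul_smul, hγ, map_mul] at h1
    exact h1
  have hφ : ∀ d ∈ W.reps, ∀ g : S, φ (g • d) = π g (y d) := fun d hd g => hval d hd g
  -- For every `s` in the stabilizer of `d'`, the element `g * s` carries `d'` to the same point of
  -- the class of `d`, so `hδ` covers the whole stabilizer orbit of `x`, hence its closed convex
  -- hull.
  have hφx : ∀ d ∈ W.reps, ∀ i, ∀ c ∈ (p i).cls d, ‖φ c - x‖ ≤ δ := by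
    intro d hd i c hc
    obtain ⟨d', hd', g, rfl⟩ := W.exists_smul c
    rw [hφ d' hd']
    refine hyball d' g x δ fun s hs => hδ d hd i d' hd' (g * s) ?_
    rwa [mul_smul, MulAction.mem_stabilizer_iff.1 hs]
  obtain ⟨ζ, hζ, hgap⟩ := exists_fixed_norm_sub_sq_le (fun i => EquivFun.avgMap W π (p i))
    (fun i => EquivFun.avgMap_isSymmetric (hp i)) (fun i φ => EquivFun.avgMap_idem (p i) φ) hl hA
    (fun i j φ => by
      by_cases hij : i = j
      · subst hij
        rw [hdiag, one_mul, real_inner_self_eq_norm_mul_norm]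
      · have h := EquivFun.neg_mul_le_inner_sub_avgMap (hp i) (hp j) (hq i j hij) (hpq i j hij)
          (hpq' i j hij) (hoff i j hij).1 (hoff i j hij).2 (hlocal i j hij) φ
        rwa [neg_neg] at h) φ
  have hζc : ∀ a b, ζ a = ζ b := hconn ζ fun i a b hb => by
    rw [← hζ i]; exact EquivFun.avgMap_of_mem (p i) ζ hb
  -- The class mean is the best constant approximation in mean square, so it does at least as well
  -- as `x`.
  have hbound : ∀ i, ‖φ - EquivFun.avgMap W π (p i) φ‖ ^ 2 ≤ W.integral fun _ : C => δ ^ 2 := by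
    intro i
    rw [EquivFun.norm_sq_def, ← W.integral_avg (hp i)]
    · refine Finset.sum_le_sum fun d hd => ?_
      simp only [smul_eq_mul]
      refine mul_le_mul_of_nonneg_left ?_ (W.weight_pos d).le
      refine ((p i).avg_norm_sub_sq_le φ x d).trans ?_
      rw [InvPartition.avg, smul_eq_mul, inv_mul_le_iff₀ ((p i).card_cls_pos d), ← nsmul_eq_mul]
      refine Finset.sum_le_card_nsmul _ _ _ fun c hc => ?_
      have := hφx d hd i c hc
      gcongr
    · intro g c
      rw [EquivFun.smul_apply', LinearIsometryEquiv.norm_map]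
  -- Otherwise the reverse strict inequality, integrated over the representatives, would contradict
  -- `hgap`.
  have hd : ∃ d ∈ W.reps, l * ‖φ d - ζ d‖ ^ 2 ≤ Fintype.card ι * δ ^ 2 := by
    by_contra! hcon
    have h1 : W.integral (fun _ : C => (Fintype.card ι : ℝ) * δ ^ 2) <
        W.integral fun d => l * ‖φ d - ζ d‖ ^ 2 :=
      Finset.sum_lt_sum_of_nonempty ⟨d₀, hd₀⟩ fun d hd =>
        mul_lt_mul_of_pos_left (hcon d hd) (W.weight_pos d)
    have h2 : W.integral (fun d => l * ‖φ d - ζ d‖ ^ 2) = l * ‖φ - ζ‖ ^ 2 := by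
      rw [EquivFun.norm_sq_def]
      simp only [WeightedDomain.integral, Finset.mul_sum, smul_eq_mul, EquivFun.sub_apply]
      exact Finset.sum_congr rfl fun d _ => by ring
    have h3 : ∑ _i : ι, W.integral (fun _ : C => δ ^ 2) =
        W.integral (fun _ : C => (Fintype.card ι : ℝ) * δ ^ 2) := by
      simp only [WeightedDomain.integral, Finset.sum_const, Finset.card_univ, nsmul_eq_mul,
        Finset.mul_sum, smul_eq_mul]
      exact Finset.sum_congr rfl fun d _ => by ring
    have h4 := hgap.trans (Finset.sum_le_sum fun i _ => hbound i)
    rw [h3, ← h2] at h4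
    exact absurd h1 (not_lt.2 h4)
  obtain ⟨d, hd, hdle⟩ := hd
  refine ⟨ζ d, fun g => ?_, ?_⟩
  · rw [← EquivFun.smul_apply', hζc]
  have h1 : ‖x - φ d‖ ≤ δ := by
    rw [norm_sub_rev]; exact hφx d hd i₀ d ((p i₀).self_mem d)
  have h2 : ‖φ d - ζ d‖ ≤ δ * √(Fintype.card ι / l) := by
    refine le_of_sq_le_sq ?_ (by positivity)
    rw [mul_pow, Real.sq_sqrt (by positivity), mul_div_assoc', le_div_iff₀ hl]
    linarith
  calc ‖x - ζ d‖ ≤ ‖x - φ d‖ + ‖φ d - ζ d‖ := norm_sub_le_norm_sub_add_norm_sub _ _ _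
    _ ≤ _ := by rw [mul_add, mul_one]; exact add_le_add h1 h2

end AlmostInvariant

/-! ### The spectral gap of a finite graph -/

section Graph

variable {W : Type*} [Fintype W] {Γ : SimpleGraph W}

open Classical in
/-- The ordered pairs of adjacent vertices. -/
noncomputable def adjPairs (Γ : SimpleGraph W) : Finset (W × W) :=
  Finset.univ.filter fun e => Γ.Adj e.1 e.2

theorem mem_adjPairs {e : W × W} : e ∈ adjPairs Γ ↔ Γ.Adj e.1 e.2 := by simp [adjPairs]

open Classical in
theorem sum_adjPairs {M : Type*} [AddCommMonoid M] (f : W × W → M) :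
    ∑ e ∈ adjPairs Γ, f e = ∑ v, ∑ u, if Γ.Adj v u then f (v, u) else 0 := by
  rw [adjPairs, Finset.sum_filter, Fintype.sum_prod_type]

theorem sum_adjPairs_swap {M : Type*} [AddCommMonoid M] (f : W × W → M) :
    ∑ e ∈ adjPairs Γ, f e.swap = ∑ e ∈ adjPairs Γ, f e :=
  Finset.sum_nbij' Prod.swap Prod.swap (fun _ he => mem_adjPairs.2 (mem_adjPairs.1 he).symm)
    (fun _ he => mem_adjPairs.2 (mem_adjPairs.1 he).symm) (fun _ _ => rfl) (fun _ _ => rfl)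
    fun _ _ => rfl

theorem randomWalk_eq [DecidableRel Γ.Adj] (φ : W → ℂ) (v : W) :
    randomWalk Γ φ v = (1 / (∑ u, if Γ.Adj v u then (1 : ℂ) else 0)) *
      ∑ u, if Γ.Adj v u then φ u else 0 := by
  rw [randomWalk, ← Finset.sum_filter, ← Finset.sum_filter]
  have h : Γ.neighborSet v = ↑(Finset.univ.filter (Γ.Adj v ·)) := by ext u; simp
  rw [h, Set.ncard_coe_finset, finsum_mem_coe_finset]
  simp

theorem mem_walkEigenvalues_of_real [DecidableRel Γ.Adj] (hdeg : ∀ v, ∃ u, Γ.Adj v u)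
    {φ : W → ℝ} (hφ : φ ≠ 0) {r : ℝ}
    (h : ∀ v, (∑ u, if Γ.Adj v u then φ u else 0) =
      r * ((∑ u, if Γ.Adj v u then (1 : ℝ) else 0) * φ v)) :
    r ∈ walkEigenvalues Γ := by
  refine ⟨fun v => φ v, fun h0 => hφ ?_, ?_⟩
  · ext v; exact Complex.ofReal_eq_zero.1 (congrFun h0 v)
  · ext v
    rw [randomWalk_eq]
    have h1 : (∑ u, if Γ.Adj v u then (φ u : ℂ) else 0) =
        r * ((∑ u, if Γ.Adj v u then (1 : ℂ) else 0) * φ v) := by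
      have := congrArg (fun x : ℝ => (x : ℂ)) (h v)
      push_cast at this
      simpa [apply_ite] using this
    have h2 : (∑ u, if Γ.Adj v u then (1 : ℂ) else 0) ≠ 0 := by
      obtain ⟨u, hu⟩ := hdeg v
      rw [← Finset.sum_filter, Finset.sum_const, nsmul_one]
      exact_mod_cast (Finset.card_pos.2 ⟨u, by simpa using hu⟩).ne'
    rw [h1]
    simp only [Pi.smul_apply, smul_eq_mul]
    field_simp

/-- An eigenfunction of the walk on a connected graph for an eigenvalue `≥ 1` is constant. -/
theorem eq_of_one_le_eigenvalue [DecidableRel Γ.Adj] (hconn : Γ.Connected) {φ : W → ℝ} {r : ℝ}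
    (hr : 1 ≤ r) (h : ∀ v, (∑ u, if Γ.Adj v u then φ u else 0) =
      r * ((∑ u, if Γ.Adj v u then (1 : ℝ) else 0) * φ v)) (v u : W) : φ v = φ u := by
  have h1 : ∑ e ∈ adjPairs Γ, φ e.1 * φ e.2 = r * ∑ e ∈ adjPairs Γ, φ e.1 ^ 2 := by
    rw [sum_adjPairs, sum_adjPairs, Finset.mul_sum]
    refine Finset.sum_congr rfl fun v _ => ?_
    have e1 : (∑ u, if Γ.Adj v u then φ v * φ u else 0) =
        φ v * ∑ u, if Γ.Adj v u then φ u else 0 := by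
      rw [Finset.mul_sum]; simp
    have e2 : (∑ u, if Γ.Adj v u then φ v ^ 2 else 0) =
        (∑ u, if Γ.Adj v u then (1 : ℝ) else 0) * φ v ^ 2 := by
      rw [Finset.sum_mul]; simp
    simp only []
    convert_to (∑ u, if Γ.Adj v u then φ v * φ u else 0) =
      r * ∑ u, if Γ.Adj v u then φ v ^ 2 else 0
    rw [e1, e2, h]; ring
  have h2 : ∑ e ∈ adjPairs Γ, φ e.2 ^ 2 = ∑ e ∈ adjPairs Γ, φ e.1 ^ 2 :=
    sum_adjPairs_swap fun e => φ e.1 ^ 2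
  -- The Dirichlet energy equals `2 * (1 - r)` times a sum of squares, so it is not positive when `1
  -- ≤ r`.
  have h3 : ∑ e ∈ adjPairs Γ, (φ e.1 - φ e.2) ^ 2 ≤ 0 := by
    have : ∑ e ∈ adjPairs Γ, (φ e.1 - φ e.2) ^ 2 =
        2 * (1 - r) * ∑ e ∈ adjPairs Γ, φ e.1 ^ 2 := by
      simp only [sub_sq, Finset.sum_add_distrib, Finset.sum_sub_distrib, h2, mul_assoc,
        ← Finset.mul_sum, h1]
      ring
    rw [this]
    have h4 : 0 ≤ ∑ e ∈ adjPairs Γ, φ e.1 ^ 2 := by positivity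
    nlinarith
  have h5 := (Finset.sum_eq_zero_iff_of_nonneg fun _ _ => by positivity).1
    (le_antisymm h3 (by positivity))
  have h6 : ∀ v u, Γ.Adj v u → φ v = φ u := fun v u hvu =>
    sub_eq_zero.1 (pow_eq_zero_iff two_ne_zero |>.1 (h5 (v, u) (mem_adjPairs.2 hvu)))
  obtain ⟨p⟩ := hconn.preconnected v u
  induction p with
  | nil => rfl
  | cons hvu _ ih => exact (h6 _ _ hvu).trans ih

/-- A positive semidefinite real matrix gives a nonnegative form on vectors of a Hilbert space. -/
theorem posSemidef_sum_inner_nonneg {H : Type*} [NormedAddCommGroup H] [InnerProductSpace ℝ H]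
    {N : Matrix W W ℝ} (hN : N.PosSemidef) (z : W → H) :
    0 ≤ ∑ v, ∑ u, N v u * inner ℝ (z v) (z u) := by
  -- Written through rank one matrices, the form becomes a sum of squared norms of linear
  -- combinations of the `z v`.
  obtain ⟨m, b, rfl⟩ := Matrix.posSemidef_iff_eq_sum_vecMulVec.1 hN
  have : ∑ v, ∑ u, (∑ i, Matrix.vecMulVec (b i) (star (b i))) v u * inner ℝ (z v) (z u) =
      ∑ i, inner ℝ (∑ v, b i v • z v) (∑ v, b i v • z v) := by
    simp only [Matrix.sum_apply, Matrix.vecMulVec_apply, star_trivial, Finset.sum_mul]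
    rw [Finset.sum_congr rfl fun v _ => Finset.sum_comm, Finset.sum_comm]
    refine Finset.sum_congr rfl fun i _ => ?_
    rw [sum_inner]
    refine Finset.sum_congr rfl fun v _ => ?_
    rw [inner_sum]
    refine Finset.sum_congr rfl fun u _ => ?_
    rw [inner_smul_left, inner_smul_right, conj_trivial, mul_assoc]
  rw [this]
  exact Finset.sum_nonneg fun i _ => real_inner_self_nonneg

/-- The spectral gap of a finite connected graph, for functions with values in a Hilbert space. -/
theorem sum_adjPairs_inner_le {H : Type*} [NormedAddCommGroup H] [InnerProductSpace ℝ H]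
    (hconn : Γ.Connected) (hdeg : ∀ v, ∃ u, Γ.Adj v u) {l : ℝ}
    (hl : ∀ r ∈ walkEigenvalues Γ, r < 1 → r ≤ l) (ψ : W → H)
    (hψ : ∑ e ∈ adjPairs Γ, ψ e.1 = 0) :
    ∑ e ∈ adjPairs Γ, inner ℝ (ψ e.1) (ψ e.2) ≤ l * ∑ e ∈ adjPairs Γ, ‖ψ e.1‖ ^ 2 := by
  classical
  let a : W → W → ℝ := fun v u => if Γ.Adj v u then 1 else 0
  have ha : ∀ v u, a v u = a u v := fun v u => by simp only [a, Γ.adj_comm]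
  let d : W → ℝ := fun v => ∑ u, a v u
  have hd : ∀ v, 0 < d v := by
    intro v
    obtain ⟨u, hu⟩ := hdeg v
    refine Finset.sum_pos' (fun u _ => by simp only [a]; positivity) ⟨u, Finset.mem_univ _, ?_⟩
    simp [a, hu]
  let s : W → ℝ := fun v => √(d v)
  have hs : ∀ v, 0 < s v := fun v => Real.sqrt_pos.2 (hd v)
  have hs2 : ∀ v, s v * s v = d v := fun v => Real.mul_self_sqrt (hd v).le
  obtain ⟨v₀⟩ := hconn.nonempty
  let D : ℝ := ∑ v, d v
  have hD : 0 < D := Finset.sum_pos (fun v _ => hd v) ⟨v₀, Finset.mem_univ _⟩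
  -- This is `l` minus the walk made symmetric by conjugation with √degree, plus a rank one term
  -- along the vector `s`. That term is chosen so that `N` kills `s`, the image of the constant
  -- functions.
  let N : Matrix W W ℝ := Matrix.of fun v u =>
    (if v = u then l else 0) - a v u / (s v * s u) + (1 - l) / D * (s v * s u)
  have hNh : N.IsHermitian := by
    ext v u
    simp only [N, Matrix.conjTranspose_apply, Matrix.of_apply, star_trivial, ha u v, eq_comm,
      mul_comm (s u)]
  have hNmul : ∀ (e : W → ℝ) v, (N.mulVec e) v =
      l * e v - (∑ u, a v u * (e u / s u)) / s v + (1 - l) / D * (s v * ∑ u, s u * e u) := by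
    intro e v
    simp only [N, Matrix.mulVec, dotProduct, Matrix.of_apply, add_mul, sub_mul,
      Finset.sum_add_distrib, Finset.sum_sub_distrib, ite_mul, zero_mul, Finset.sum_ite_eq,
      Finset.mem_univ, if_true, Finset.mul_sum, Finset.sum_div]
    congr 1
    · congr 1
      refine Finset.sum_congr rfl fun u _ => ?_
      have := (hs v).ne'; have := (hs u).ne'
      field_simp
    · exact Finset.sum_congr rfl fun u _ => by ring
  have hNpsd : N.PosSemidef := by
    rw [hNh.posSemidef_iff_eigenvalues_nonneg]
    intro k
    let e : W → ℝ := (hNh.eigenvectorBasis k).ofLp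
    have he0 : e ≠ 0 := by
      intro h
      have h1 := hNh.eigenvectorBasis.orthonormal.1 k
      have h2 : hNh.eigenvectorBasis k = 0 := by ext v; exact congrFun h v
      rw [h2, norm_zero] at h1
      exact zero_ne_one h1
    have he : ∀ v, l * e v - (∑ u, a v u * (e u / s u)) / s v +
        (1 - l) / D * (s v * ∑ u, s u * e u) = hNh.eigenvalues k * e v := by
      intro v
      rw [← hNmul e v]
      exact congrFun (hNh.mulVec_eigenvectorBasis k) v
    obtain ⟨ν, hν⟩ : ∃ ν, ν = hNh.eigenvalues k := ⟨_, rfl⟩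
    rw [← hν] at he
    change 0 ≤ hNh.eigenvalues k
    rw [← hν]
    obtain ⟨c, hc⟩ : ∃ c, c = ∑ u, s u * e u := ⟨_, rfl⟩
    rw [← hc] at he
    have hsum : ∑ v, s v * ((∑ u, a v u * (e u / s u)) / s v) = c := by
      have : ∀ v, s v * ((∑ u, a v u * (e u / s u)) / s v) = ∑ u, a v u * (e u / s u) :=
        fun v => mul_div_cancel₀ _ (hs v).ne'
      simp only [this]
      rw [Finset.sum_comm, hc]
      refine Finset.sum_congr rfl fun u _ => ?_
      rw [← Finset.sum_mul]
      have : ∑ v, a v u = s u * s u := by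
        rw [hs2]; exact Finset.sum_congr rfl fun v _ => ha v u
      rw [this]
      have := (hs u).ne'
      field_simp
    -- Pairing the eigenvector equation with `s`, which `N` kills: either `ν = 0` or the eigenvector
    -- is orthogonal to `s`.
    have hνc : ν * c = 0 := by
      have h1 : ∑ v, s v * (l * e v - (∑ u, a v u * (e u / s u)) / s v +
          (1 - l) / D * (s v * c)) = ∑ v, s v * (ν * e v) :=
        Finset.sum_congr rfl fun v _ => by rw [he]
      have h2 : ∑ v, s v * (ν * e v) = ν * c := by
        rw [hc, Finset.mul_sum]; exact Finset.sum_congr rfl fun v _ => by ring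
      have h3 : ∑ v, s v * (l * e v) = l * c := by
        rw [hc, Finset.mul_sum]; exact Finset.sum_congr rfl fun v _ => by ring
      have h4 : ∑ v, s v * ((1 - l) / D * (s v * c)) = (1 - l) * c := by
        have : ∀ v, s v * ((1 - l) / D * (s v * c)) = d v * ((1 - l) / D * c) := fun v => by
          rw [← hs2]; ring
        simp only [this]
        rw [← Finset.sum_mul]
        change D * _ = _
        field_simp
      simp only [mul_add, mul_sub, Finset.sum_add_distrib, Finset.sum_sub_distrib] at h1
      rw [h2, h3, h4, hsum] at h1
      linarith
    rcases mul_eq_zero.1 hνc with h0 | h0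
    · exact h0.ge
    · rw [h0] at he
      have hφ : ∀ v, (∑ u, if Γ.Adj v u then e u / s u else 0) =
          (l - ν) * ((∑ u, if Γ.Adj v u then (1 : ℝ) else 0) * (e v / s v)) := by
        intro v
        have h1 := he v
        have h2 : (∑ u, if Γ.Adj v u then e u / s u else 0) = ∑ u, a v u * (e u / s u) := by
          simp [a]
        change _ = (l - ν) * (d v * (e v / s v))
        rw [h2, ← hs2]
        have := (hs v).ne'
        rw [mul_zero, mul_zero, add_zero, sub_eq_iff_eq_add, ← sub_eq_iff_eq_add',
          eq_div_iff this] at h1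
        rw [← h1]
        field_simp
      -- Now `e / s` is an eigenfunction of the walk with eigenvalue `l - ν`. Below 1 the hypothesis
      -- `hl` gives `0 ≤ ν`; otherwise the function is constant, and orthogonality to `s` forces it
      -- to vanish.
      by_cases hr : l - ν < 1
      · have h1 : (fun v => e v / s v) ≠ 0 := by
          intro h
          refine he0 (funext fun v => ?_)
          have := congrFun h v
          exact (div_eq_zero_iff.1 this).resolve_right (hs v).ne'
        have := hl _ (mem_walkEigenvalues_of_real hdeg h1 hφ) hr
        linarith
      · exfalso
        have h1 := eq_of_one_le_eigenvalue hconn (not_lt.1 hr) hφ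
        have h2 : ∀ v, e v = s v * (e v₀ / s v₀) := fun v => by
          rw [← h1 v v₀, mul_div_cancel₀ _ (hs v).ne']
        have h3 : D * (e v₀ / s v₀) = 0 := by
          rw [← h0, hc, Finset.sum_mul]
          refine Finset.sum_congr rfl fun v _ => ?_
          rw [h2 v, ← hs2]; ring
        have h4 := (mul_eq_zero.1 h3).resolve_left hD.ne'
        exact he0 (funext fun v => by rw [h2, h4, mul_zero]; rfl)
  have hform := posSemidef_sum_inner_nonneg hNpsd fun v => s v • ψ v
  have hψ' : ∑ v, d v • ψ v = 0 := by
    rw [sum_adjPairs] at hψ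
    rw [← hψ]
    refine Finset.sum_congr rfl fun v _ => ?_
    simp only [d, a, Finset.sum_smul, ite_smul, one_smul, zero_smul]
  have hexp : ∑ v, ∑ u, N v u * inner ℝ (s v • ψ v) (s u • ψ u) =
      l * ∑ e ∈ adjPairs Γ, ‖ψ e.1‖ ^ 2 - ∑ e ∈ adjPairs Γ, inner ℝ (ψ e.1) (ψ e.2) +
        (1 - l) / D * inner ℝ (∑ v, d v • ψ v) (∑ u, d u • ψ u) := by
    rw [sum_adjPairs, sum_adjPairs, sum_inner, Finset.mul_sum, Finset.mul_sum,
      ← Finset.sum_sub_distrib, ← Finset.sum_add_distrib]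
    refine Finset.sum_congr rfl fun v _ => ?_
    have h1 : ∀ u, N v u * inner ℝ (s v • ψ v) (s u • ψ u) =
        (if v = u then l * (d v * ‖ψ v‖ ^ 2) else 0) - a v u * inner ℝ (ψ v) (ψ u) +
          (1 - l) / D * inner ℝ (d v • ψ v) (d u • ψ u) := by
      intro u
      simp only [N, Matrix.of_apply, inner_smul_left, inner_smul_right, conj_trivial]
      have e1 := (hs v).ne'
      have e2 := (hs u).ne'
      rw [← hs2 v, ← hs2 u, ← real_inner_self_eq_norm_sq]
      split_ifs with h
      · subst h; field_simp
      · field_simp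
        ring
    rw [Finset.sum_congr rfl fun u _ => h1 u, Finset.sum_add_distrib, Finset.sum_sub_distrib,
      Finset.sum_ite_eq, if_pos (Finset.mem_univ v), inner_sum, Finset.mul_sum]
    congr 2
    · simp only [d, a, Finset.sum_mul, ite_mul, one_mul, zero_mul]
      rw [Finset.mul_sum]
    · simp [a]
    · rw [Finset.mul_sum]
  rw [hexp, hψ', inner_zero_left, mul_zero, add_zero] at hform
  linarith


/-- The sum over ordered pairs of adjacent vertices of a bipartite graph, in terms of its edges. -/
theorem sum_adjPairs_eq_sum_edges {C M : Type*} [AddCommMonoid M] {B : Finset C} {α β : C → W}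
    {s : Set W} (hα : ∀ σ ∈ B, α σ ∈ s) (hadj : ∀ σ ∈ B, Γ.Adj (α σ) (β σ))
    (hsurj : ∀ v u, Γ.Adj v u → v ∈ s → ∃ σ ∈ B, α σ = v ∧ β σ = u)
    (hs : ∀ v u, Γ.Adj v u → (v ∈ s ↔ u ∉ s))
    (hinj : ∀ σ ∈ B, ∀ σ' ∈ B, α σ = α σ' → β σ = β σ' → σ = σ') (F : W × W → M) :
    ∑ e ∈ adjPairs Γ, F e = ∑ σ ∈ B, (F (α σ, β σ) + F (β σ, α σ)) := by
  classical
  have key : ∀ F : W × W → M,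
      ∑ e ∈ (adjPairs Γ).filter (fun e => e.1 ∈ s), F e = ∑ σ ∈ B, F (α σ, β σ) := by
    intro F
    symm
    refine Finset.sum_nbij (fun σ => (α σ, β σ)) ?_ ?_ ?_ fun _ _ => rfl
    · exact fun σ hσ => Finset.mem_filter.2 ⟨mem_adjPairs.2 (hadj σ hσ), hα σ hσ⟩
    · exact fun σ hσ σ' hσ' h =>
        hinj σ hσ σ' hσ' (congrArg Prod.fst h) (congrArg Prod.snd h)
    · rintro ⟨v, u⟩ he
      obtain ⟨he, hv⟩ := Finset.mem_filter.1 he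
      obtain ⟨σ, hσ, h1, h2⟩ := hsurj v u (mem_adjPairs.1 he) hv
      exact ⟨σ, hσ, Prod.ext h1 h2⟩
  rw [← Finset.sum_filter_add_sum_filter_not (adjPairs Γ) (fun e => e.1 ∈ s),
    Finset.sum_add_distrib, ← key F,
    show ∑ σ ∈ B, F (β σ, α σ) = _ from (key fun e => F e.swap).symm]
  congr 1
  refine Finset.sum_nbij' Prod.swap Prod.swap ?_ ?_ (fun _ _ => rfl) (fun _ _ => rfl)
    fun _ _ => rfl
  · intro e he
    obtain ⟨he, hv⟩ := Finset.mem_filter.1 he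
    have h := (mem_adjPairs.1 he).symm
    exact Finset.mem_filter.2 ⟨mem_adjPairs.2 h, (hs _ _ h).2 hv⟩
  · intro e he
    obtain ⟨he, hv⟩ := Finset.mem_filter.1 he
    have h := (mem_adjPairs.1 he)
    exact Finset.mem_filter.2 ⟨mem_adjPairs.2 h.symm, (hs _ _ h).1 hv⟩

/-- The spectral gap of a bipartite graph, for pairs of functions on its edges that depend only on
one end of each edge. -/
theorem two_mul_sum_edges_inner_le {H : Type*} [NormedAddCommGroup H] [InnerProductSpace ℝ H]
    (hconn : Γ.Connected) {C : Type*} {B : Finset C} {α β : C → W}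
    {s : Set W} (hα : ∀ σ ∈ B, α σ ∈ s) (hβ : ∀ σ ∈ B, β σ ∉ s)
    (hadj : ∀ σ ∈ B, Γ.Adj (α σ) (β σ))
    (hsurj : ∀ v u, Γ.Adj v u → v ∈ s → ∃ σ ∈ B, α σ = v ∧ β σ = u)
    (hs : ∀ v u, Γ.Adj v u → (v ∈ s ↔ u ∉ s))
    (hinj : ∀ σ ∈ B, ∀ σ' ∈ B, α σ = α σ' → β σ = β σ' → σ = σ')
    (hcover : ∀ v, ∃ σ ∈ B, α σ = v ∨ β σ = v) {l : ℝ}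
    (hl : ∀ r ∈ walkEigenvalues Γ, r < 1 → r ≤ l) {f g : C → H}
    (hf : ∀ σ ∈ B, ∀ σ' ∈ B, β σ = β σ' → f σ = f σ')
    (hg : ∀ σ ∈ B, ∀ σ' ∈ B, α σ = α σ' → g σ = g σ')
    (hf0 : ∑ σ ∈ B, f σ = 0) (hg0 : ∑ σ ∈ B, g σ = 0) :
    2 * ∑ σ ∈ B, inner ℝ (f σ) (g σ) ≤ l * ∑ σ ∈ B, (‖f σ‖ ^ 2 + ‖g σ‖ ^ 2) := by
  classical
  choose ρ hρ hρv using hcover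
  -- The two edge functions are glued into one vertex function: `g` lives on the side of the ends
  -- `α`, and `f` on the side of the ends `β`.
  let ψ : W → H := fun v => if v ∈ s then g (ρ v) else f (ρ v)
  have hψα : ∀ σ ∈ B, ψ (α σ) = g σ := by
    intro σ hσ
    simp only [ψ, if_pos (hα σ hσ)]
    refine hg _ (hρ _) _ hσ ((hρv (α σ)).resolve_right fun h => ?_)
    exact hβ _ (hρ (α σ)) (by rw [h]; exact hα σ hσ)
  have hψβ : ∀ σ ∈ B, ψ (β σ) = f σ := by
    intro σ hσ
    simp only [ψ, if_neg (hβ σ hσ)]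
    refine hf _ (hρ _) _ hσ ((hρv (β σ)).resolve_left fun h => ?_)
    exact hβ σ hσ (by rw [← h]; exact hα _ (hρ (β σ)))
  have hdeg : ∀ v, ∃ u, Γ.Adj v u := by
    intro v
    rcases hρv v with h | h
    · exact ⟨_, h ▸ hadj _ (hρ v)⟩
    · exact ⟨_, h ▸ (hadj _ (hρ v)).symm⟩
  have h := sum_adjPairs_inner_le hconn hdeg hl ψ (by
    rw [sum_adjPairs_eq_sum_edges hα hadj hsurj hs hinj fun e => ψ e.1,
      Finset.sum_add_distrib, Finset.sum_congr rfl hψα, Finset.sum_congr rfl hψβ, hf0, hg0,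
      add_zero])
  rw [sum_adjPairs_eq_sum_edges hα hadj hsurj hs hinj,
    sum_adjPairs_eq_sum_edges hα hadj hsurj hs hinj] at h
  have e1 : ∑ σ ∈ B, (inner ℝ (ψ (α σ)) (ψ (β σ)) + inner ℝ (ψ (β σ)) (ψ (α σ))) =
      2 * ∑ σ ∈ B, inner ℝ (f σ) (g σ) := by
    rw [Finset.mul_sum]
    refine Finset.sum_congr rfl fun σ hσ => ?_
    rw [hψα σ hσ, hψβ σ hσ, real_inner_comm]; ring
  have e2 : ∑ σ ∈ B, (‖ψ (α σ)‖ ^ 2 + ‖ψ (β σ)‖ ^ 2) = ∑ σ ∈ B, (‖f σ‖ ^ 2 + ‖g σ‖ ^ 2) :=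
    Finset.sum_congr rfl fun σ hσ => by rw [hψα σ hσ, hψβ σ hσ, add_comm]
  rwa [← e1, ← e2]

theorem le_secondEigenvalue {W : Type*} {Γ : SimpleGraph W} {r : ℝ} (hr : r ∈ walkEigenvalues Γ)
    (hr1 : r < 1) : r ≤ secondEigenvalue Γ :=
  le_csSup ⟨1, fun _ h => h.2.le⟩ ⟨hr, hr1⟩

theorem secondEigenvalue_le_one {W : Type*} (Γ : SimpleGraph W) : secondEigenvalue Γ ≤ 1 :=
  Real.sSup_le (fun _ h => h.2.le) zero_le_one

/-- The spectrum of the walk on a bipartite graph is symmetric. -/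
theorem neg_mem_walkEigenvalues {W : Type*} {Γ : SimpleGraph W} {s : Set W}
    (hs : ∀ v u, Γ.Adj v u → (v ∈ s ↔ u ∉ s)) {r : ℝ} (hr : r ∈ walkEigenvalues Γ) :
    -r ∈ walkEigenvalues Γ := by
  classical
  obtain ⟨φ, hφ, h⟩ := hr
  -- Changing the sign on one side of the bipartition turns an eigenvalue `r` into `-r`.
  let ε : W → ℂ := fun v => if v ∈ s then 1 else -1
  have hε : ∀ v, ε v ≠ 0 := fun v => by simp only [ε]; split_ifs <;> simp
  refine ⟨fun v => ε v * φ v, fun h0 => hφ (funext fun v => ?_), funext fun v => ?_⟩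
  · exact (mul_eq_zero.1 (congrFun h0 v)).resolve_left (hε v)
  · have h1 := congrFun h v
    simp only [randomWalk, Pi.smul_apply, smul_eq_mul] at h1 ⊢
    have h2 : ∑ᶠ u ∈ Γ.neighborSet v, ε u * φ u = -ε v * ∑ᶠ u ∈ Γ.neighborSet v, φ u := by
      rw [mul_finsum_mem]
      refine finsum_mem_congr rfl fun u hu => ?_
      have h3 := hs v u hu
      simp only [ε]
      by_cases hv : v ∈ s
      · simp [hv, h3.1 hv]
      · have : u ∈ s := by by_contra hu'; exact hv (h3.2 hu')
        simp [hv, this]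
    rw [h2, ← mul_assoc, mul_comm _ (-ε v), mul_assoc, h1]
    push_cast; ring

/-- The second eigenvalue of a bipartite graph is nonnegative, unless it is `≤ -1`. -/
theorem secondEigenvalue_nonneg {W : Type*} {Γ : SimpleGraph W} {s : Set W}
    (hs : ∀ v u, Γ.Adj v u → (v ∈ s ↔ u ∉ s)) (h : -1 < secondEigenvalue Γ) :
    0 ≤ secondEigenvalue Γ := by
  -- With no eigenvalue below 1 the supremum takes its default value 0. Otherwise some eigenvalue `r
  -- > -1` exists, and both `r` and `-r` are below 1, so the supremum bounds both.
  rcases Set.eq_empty_or_nonempty {r | r ∈ walkEigenvalues Γ ∧ r < 1} with h0 | h0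
  · rw [secondEigenvalue, h0, Real.sSup_empty]
  · obtain ⟨r, ⟨hr, hr1⟩, hr2⟩ := exists_lt_of_lt_csSup h0 h
    have h1 := le_secondEigenvalue hr hr1
    have h2 := le_secondEigenvalue (neg_mem_walkEigenvalues hs hr) (by linarith)
    linarith

end Graph

/-! ### Chambers of partite complexes -/

section Chambers

variable {V : Type*} [DecidableEq V] {X : PreAbstractSimplicialComplex V} {n : ℕ}
  {c : V → Fin (n + 1)}

theorem mem_faces_of_subset {σ τ : Finset V} (hσ : σ ∈ X.faces) (h : τ ⊆ σ) (hτ : τ.Nonempty) :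
    τ ∈ X.faces :=
  (X.isRelLowerSet_faces hσ).2 h hτ

theorem card_of_mem_cells {σ : Finset V} (h : σ ∈ cells X n) : σ.card = n + 1 := by
  have := h.2; omega

theorem mem_faces_of_mem_cells {σ : Finset V} (h : σ ∈ cells X n) : σ ∈ X.faces := by
  refine h.1.resolve_right fun h0 => ?_
  have := card_of_mem_cells h
  rw [h0] at this
  simp at this

theorem mem_cells_of_subset {σ τ : Finset V} (hσ : σ ∈ cells X n) (h : τ ⊆ σ) {k : ℤ}
    (hk : (τ.card : ℤ) = k + 1) : τ ∈ cells X k := by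
  refine ⟨?_, hk⟩
  rcases τ.eq_empty_or_nonempty with h0 | h0
  · exact Or.inr h0
  · exact Or.inl (mem_faces_of_subset (mem_faces_of_mem_cells hσ) h h0)

theorem IsPartite.eq_of_type_eq (hpart : IsPartite X n c) {σ : Finset V} (hσ : σ ∈ cells X n)
    {v u : V} (hv : v ∈ σ) (hu : u ∈ σ) (h : c v = c u) : v = u :=
  (hpart σ hσ (c u)).unique ⟨hv, h⟩ ⟨hu, rfl⟩

theorem IsPartite.exists_vertex (hpart : IsPartite X n c) {σ : Finset V} (hσ : σ ∈ cells X n)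
    (i : Fin (n + 1)) : ∃ v ∈ σ, c v = i :=
  (hpart σ hσ i).exists

/-- The part of `σ` whose types do not lie in `J`. -/
def outer (c : V → Fin (n + 1)) (J : Finset (Fin (n + 1))) (σ : Finset V) : Finset V :=
  σ.filter fun v => c v ∉ J

theorem mem_outer {J : Finset (Fin (n + 1))} {σ : Finset V} {v : V} :
    v ∈ outer c J σ ↔ v ∈ σ ∧ c v ∉ J := Finset.mem_filter

theorem outer_subset (J : Finset (Fin (n + 1))) (σ : Finset V) : outer c J σ ⊆ σ :=
  Finset.filter_subset _ _

theorem outer_eq_of_subset {J J' : Finset (Fin (n + 1))} (hJ : J ⊆ J') {σ σ' : Finset V}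
    (h : outer c J σ = outer c J σ') : outer c J' σ = outer c J' σ' := by
  have key : ∀ σ, outer c J' σ = outer c J' (outer c J σ) := by
    intro σ; ext v
    simp only [mem_outer]
    exact ⟨fun h => ⟨⟨h.1, fun h' => h.2 (hJ h')⟩, h.2⟩, fun h => ⟨h.1.1, h.2⟩⟩
  rw [key σ, key σ', h]

theorem IsPartite.image_outer (hpart : IsPartite X n c) (J : Finset (Fin (n + 1))) {σ : Finset V}
    (hσ : σ ∈ cells X n) : (outer c J σ).image c = Jᶜ := by
  ext i
  simp only [Finset.mem_image, mem_outer, Finset.mem_compl]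
  constructor
  · rintro ⟨v, ⟨-, hv⟩, rfl⟩; exact hv
  · intro hi
    obtain ⟨v, hv, rfl⟩ := hpart.exists_vertex hσ i
    exact ⟨v, ⟨hv, hi⟩, rfl⟩

theorem IsPartite.card_outer (hpart : IsPartite X n c) (J : Finset (Fin (n + 1))) {σ : Finset V}
    (hσ : σ ∈ cells X n) : (outer c J σ).card + J.card = n + 1 := by
  rw [← Finset.card_image_of_injOn (f := c), hpart.image_outer J hσ, Finset.card_compl,
    Fintype.card_fin]
  · have := J.card_le_univ
    rw [Fintype.card_fin] at this
    omega
  · intro v hv u hu h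
    exact hpart.eq_of_type_eq hσ (outer_subset _ _ hv) (outer_subset _ _ hu) h

/-- A chamber that contains the outer part of another one has the same outer part. -/
theorem IsPartite.outer_eq (hpart : IsPartite X n c) {J : Finset (Fin (n + 1))} {σ σ' : Finset V}
    (hσ : σ ∈ cells X n) (hσ' : σ' ∈ cells X n) (h : outer c J σ ⊆ σ') :
    outer c J σ' = outer c J σ := by
  refine (Finset.eq_of_subset_of_card_le (fun v hv => ?_) ?_).symm
  · exact mem_outer.2 ⟨h hv, (mem_outer.1 hv).2⟩
  · have h1 := hpart.card_outer J hσ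
    have h2 := hpart.card_outer J hσ'
    omega

/-- A chamber containing the codimension-two simplex consists of vertices of that simplex and of its
finite link. -/
theorem IsPartite.finite_outer_eq (hpart : IsPartite X n c) (hlink : HasFiniteConnectedLinks X n)
    {i j : Fin (n + 1)} (hij : i ≠ j) {σ : Finset V} (hσ : σ ∈ cells X n) :
    {σ' | σ' ∈ cells X n ∧ outer c {i, j} σ' = outer c {i, j} σ}.Finite := by
  have hcard := hpart.card_outer {i, j} hσ
  rw [Finset.card_pair hij] at hcard
  have hη : outer c {i, j} σ ∈ cells X ((n : ℤ) - 2) :=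
    mem_cells_of_subset hσ (outer_subset _ _) (by omega)
  obtain ⟨hfin, -⟩ := hlink _ hη
  have hF : {v : V | {v} ∈ (link X (outer c {i, j} σ)).faces}.Finite := hfin
  refine (((outer c {i, j} σ) ∪ hF.toFinset).powerset.finite_toSet).subset ?_
  rintro σ' ⟨hσ', h⟩
  simp only [Finset.coe_powerset, Set.mem_preimage, Set.mem_powerset_iff, Finset.coe_subset]
  intro v hv
  rw [Finset.mem_union, Set.Finite.mem_toFinset]
  by_cases hvη : v ∈ outer c {i, j} σ
  · exact Or.inl hvη
  · refine Or.inr ⟨Finset.singleton_nonempty v, Finset.disjoint_singleton_right.2 hvη, ?_⟩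
    refine mem_faces_of_subset (mem_faces_of_mem_cells hσ') (Finset.union_subset ?_ ?_)
      ⟨v, Finset.mem_union_right _ (Finset.mem_singleton_self v)⟩
    · rw [← h]; exact outer_subset _ _
    · simpa using hv

/-- The `n` common vertices miss some type `i`, and by counting they are the whole part of `σ` away
from type `i`. -/
theorem IsPartite.exists_outer_eq (hpart : IsPartite X n c) {σ σ' : Finset V}
    (hσ : σ ∈ cells X n) (hσ' : σ' ∈ cells X n) (h : σ ∩ σ' ∈ cells X ((n : ℤ) - 1)) :
    ∃ i, outer c {i} σ' = outer c {i} σ := by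
  have hcard : (σ ∩ σ').card = n := by have := h.2; omega
  have h1 : (σ ∩ σ').image c ≠ Finset.univ := by
    intro h2
    have h3 := Finset.card_image_le (s := σ ∩ σ') (f := c)
    rw [h2, Finset.card_univ, Fintype.card_fin, hcard] at h3
    omega
  obtain ⟨i, hi⟩ : ∃ i, i ∉ (σ ∩ σ').image c := by
    by_contra! h2
    exact h1 (Finset.eq_univ_iff_forall.2 h2)
  refine ⟨i, hpart.outer_eq hσ hσ' ?_⟩
  have h2 : σ ∩ σ' ⊆ outer c {i} σ := by
    intro v hv
    refine mem_outer.2 ⟨(Finset.mem_inter.1 hv).1, fun h => hi ?_⟩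
    exact Finset.mem_image.2 ⟨v, hv, Finset.mem_singleton.1 h⟩
  have h3 := hpart.card_outer {i} hσ
  rw [Finset.card_singleton] at h3
  rw [← Finset.eq_of_subset_of_card_le h2 (by omega)]
  exact Finset.inter_subset_right

/-- Functions on the chambers that are constant along all panels are constant. -/
theorem IsGalleryConnected.eq_of_outer_eq (hgal : IsGalleryConnected X n)
    (hpart : IsPartite X n c) {F : Type*} {φ : cells X n → F}
    (hφ : ∀ i, ∀ a b : cells X n, outer c {i} b.1 = outer c {i} a.1 → φ b = φ a)
    (a b : cells X n) : φ a = φ b := by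
  have key : ∀ σ', Relation.ReflTransGen
      (fun a b => a ∈ cells X n ∧ b ∈ cells X n ∧ a ∩ b ∈ cells X ((n : ℤ) - 1)) a.1 σ' →
      ∀ h : σ' ∈ cells X n, φ a = φ ⟨σ', h⟩ := by
    intro σ' h
    induction h with
    | refl => intro _; rfl
    | tail _ h ih =>
      intro h'
      obtain ⟨i, hi⟩ := hpart.exists_outer_eq h.1 h' h.2.2
      exact (ih h.1).trans (hφ i ⟨_, h.1⟩ ⟨_, h'⟩ hi).symm
  exact key b.1 (hgal a.1 a.2 b.1 b.2) b.2

section Link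

variable {i j : Fin (n + 1)} {σ₀ : Finset V}

theorem mem_link_of_mem {J : Finset (Fin (n + 1))} {σ τ : Finset V}
    (hσ : σ ∈ cells X n) (h : outer c J σ = outer c J σ₀) (hτ : τ ⊆ σ) (hτ0 : τ.Nonempty)
    (hτJ : ∀ v ∈ τ, c v ∈ J) : τ ∈ (link X (outer c J σ₀)).faces := by
  refine ⟨hτ0, ?_, ?_⟩
  · exact Finset.disjoint_right.2 fun v hv hv' => (mem_outer.1 hv').2 (hτJ v hv)
  · refine mem_faces_of_subset (mem_faces_of_mem_cells hσ) (Finset.union_subset ?_ hτ)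
      (hτ0.mono Finset.subset_union_right)
    rw [← h]; exact outer_subset _ _

/-- Purity extends the union with `τ` to a chamber, whose outer part is then forced. A vertex of `τ`
with type outside `J` would lie in that outer part, against disjointness. -/
theorem exists_cell_of_mem_link (hpure : IsPure X n) (hpart : IsPartite X n c)
    (hσ₀ : σ₀ ∈ cells X n) {J : Finset (Fin (n + 1))} {τ : Finset V}
    (hτ : τ ∈ (link X (outer c J σ₀)).faces) :
    ∃ σ ∈ cells X n, outer c J σ = outer c J σ₀ ∧ τ ⊆ σ ∧ ∀ v ∈ τ, c v ∈ J := by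
  obtain ⟨-, hdisj, hτ⟩ := hτ
  obtain ⟨σ, hσ, hsub⟩ := hpure.2.2 _ hτ
  have h1 : outer c J σ = outer c J σ₀ :=
    hpart.outer_eq hσ₀ hσ (Finset.subset_union_left.trans hsub)
  refine ⟨σ, hσ, h1, Finset.subset_union_right.trans hsub, fun v hv => ?_⟩
  by_contra hvJ
  refine Finset.disjoint_right.1 hdisj hv ?_
  rw [← h1]
  exact mem_outer.2 ⟨hsub (Finset.mem_union_right _ hv), hvJ⟩

/-- Link graphs of simplices of codimension two are bipartite. -/
theorem link_bipartite (hpure : IsPure X n) (hpart : IsPartite X n c) (hσ₀ : σ₀ ∈ cells X n)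
    (v u : {v : V // {v} ∈ (link X (outer c {i, j} σ₀)).faces})
    (h : (graph (link X (outer c {i, j} σ₀))).Adj v u) :
    c v.1 = i ↔ ¬c u.1 = i := by
  obtain ⟨hne, hvu⟩ := h
  obtain ⟨σ, hσ, -, hsub, htype⟩ := exists_cell_of_mem_link hpure hpart hσ₀ hvu
  have hv := htype v.1 (by simp)
  have hu := htype u.1 (by simp)
  simp only [Finset.mem_insert, Finset.mem_singleton] at hv hu
  have hcne : c v.1 ≠ c u.1 := fun h =>
    hne (Subtype.ext (hpart.eq_of_type_eq hσ (hsub (by simp)) (hsub (by simp)) h))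
  constructor
  · intro h1 h2; exact hcne (h1.trans h2.symm)
  · intro h1
    rcases hv with hv | hv
    · exact hv
    · exact absurd (hv.trans (hu.resolve_left h1).symm) hcne

theorem outer_mem_cells (hpart : IsPartite X n c) (hσ₀ : σ₀ ∈ cells X n) (hij : i ≠ j) :
    outer c {i, j} σ₀ ∈ cells X ((n : ℤ) - 2) := by
  have hcard := hpart.card_outer {i, j} hσ₀
  rw [Finset.card_pair hij] at hcard
  exact mem_cells_of_subset hσ₀ (outer_subset _ _) (by omega)

theorem secondEigenvalue_le_linkLambda (hpart : IsPartite X n c) (hσ₀ : σ₀ ∈ cells X n)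
    (hij : i ≠ j) : secondEigenvalue (graph (link X (outer c {i, j} σ₀))) ≤ linkLambda X n c i j :=
  le_csSup ⟨1, by rintro _ ⟨η, -, -, rfl⟩; exact secondEigenvalue_le_one _⟩
    ⟨_, outer_mem_cells hpart hσ₀ hij, hpart.image_outer _ hσ₀, rfl⟩

/-- Some link has second eigenvalue above -1; it is bipartite, so its spectrum is symmetric and that
eigenvalue is nonnegative. -/
theorem linkLambda_nonneg (hpure : IsPure X n) (hpart : IsPartite X n c) (hij : i ≠ j)
    (h : -1 < linkLambda X n c i j) : 0 ≤ linkLambda X n c i j := by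
  obtain ⟨σ₁, hσ₁⟩ := hpure.2.1
  have hne : {r | ∃ η ∈ cells X ((n : ℤ) - 2), η.image c = ({i, j} : Finset (Fin (n + 1)))ᶜ ∧
      r = secondEigenvalue (graph (link X η))}.Nonempty :=
    ⟨_, outer c {i, j} σ₁, outer_mem_cells hpart hσ₁ hij, hpart.image_outer _ hσ₁, rfl⟩
  obtain ⟨_, ⟨η, hη, himg, rfl⟩, hr⟩ := exists_lt_of_lt_csSup hne h
  obtain ⟨σ, hσ, hsub⟩ : ∃ σ ∈ cells X n, η ⊆ σ := by
    rcases hη.1 with h0 | h0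
    · exact hpure.2.2 η h0
    · exact ⟨σ₁, hσ₁, by simp [h0]⟩
  have hησ : η = outer c {i, j} σ := by
    have h1 : η ⊆ outer c {i, j} σ := by
      intro v hv
      refine mem_outer.2 ⟨hsub hv, ?_⟩
      rw [← Finset.mem_compl, ← himg]
      exact Finset.mem_image_of_mem c hv
    refine Finset.eq_of_subset_of_card_le h1 ?_
    have h2 := (outer_mem_cells hpart hσ hij).2
    have h3 := hη.2
    omega
  rw [hησ] at hr
  exact (secondEigenvalue_nonneg (s := {v | c v.1 = i}) (link_bipartite hpure hpart hσ) hr).trans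
    (secondEigenvalue_le_linkLambda hpart hσ hij)

/-- The quadratic form at e_i ± e_j gives -1 < λ_{i,j} < 1; bipartiteness of the links improves the
lower bound to 0. -/
theorem linkLambda_mem_Ico (hpure : IsPure X n) (hpart : IsPartite X n c)
    (hpos : (linkMatrix X n c).PosDef) (hij : i ≠ j) :
    0 ≤ linkLambda X n c i j ∧ linkLambda X n c i j < 1 := by
  have hsymm : linkLambda X n c j i = linkLambda X n c i j := by
    have := hpos.isHermitian.apply i j
    simpa [linkMatrix, hij, hij.symm] using this
  have key : ∀ t : ℝ, 0 < 1 + t * t - 2 * t * linkLambda X n c i j := by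
    intro t
    have hne : (Pi.single i 1 + Pi.single j t : Fin (n + 1) → ℝ) ≠ 0 := by
      intro h
      have := congrFun h i
      simp [hij] at this
    have h := hpos.dotProduct_mulVec_pos hne
    simp only [star_trivial, Matrix.mulVec_add, add_dotProduct, dotProduct_add,
      single_dotProduct, Matrix.mulVec_single, Pi.smul_apply, Matrix.col_apply,
      MulOpposite.smul_eq_mul_unop, MulOpposite.unop_op, linkMatrix, Matrix.of_apply, if_neg hij,
      if_neg hij.symm, if_true, hsymm] at h
    linarith
  have h1 := key 1
  have h2 := key (-1)
  exact ⟨linkLambda_nonneg hpure hpart hij (by linarith), by linarith⟩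

/-- The angle inequality for functions on the chambers around a simplex of codimension two. -/
theorem two_mul_sum_inner_le {H : Type*} [NormedAddCommGroup H] [InnerProductSpace ℝ H]
    (hpure : IsPure X n) (hpart : IsPartite X n c) (hlink : HasFiniteConnectedLinks X n)
    (hij : i ≠ j) (a : cells X n) (B : Finset (cells X n))
    (hB : ∀ b : cells X n, b ∈ B ↔ outer c {i, j} b.1 = outer c {i, j} a.1) {f g : cells X n → H}
    (hf : ∀ a b : cells X n, outer c {i} b.1 = outer c {i} a.1 → f b = f a)
    (hg : ∀ a b : cells X n, outer c {j} b.1 = outer c {j} a.1 → g b = g a)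
    (hf0 : ∑ b ∈ B, f b = 0) (hg0 : ∑ b ∈ B, g b = 0) :
    2 * ∑ b ∈ B, inner ℝ (f b) (g b) ≤
      linkLambda X n c i j * ∑ b ∈ B, (‖f b‖ ^ 2 + ‖g b‖ ^ 2) := by
  classical
  obtain ⟨hfin, hconn⟩ := hlink _ (outer_mem_cells hpart a.2 hij)
  have hle := secondEigenvalue_le_linkLambda (X := X) hpart a.2 hij
  have hexists : ∀ τ ∈ (link X (outer c {i, j} a.1)).faces,
      ∃ σ ∈ B, τ ⊆ σ.1 ∧ ∀ v ∈ τ, c v = i ∨ c v = j := by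
    intro τ hτ
    obtain ⟨σ, hσ, h1, h2, h3⟩ := exists_cell_of_mem_link hpure hpart a.2 hτ
    refine ⟨⟨σ, hσ⟩, (hB _).2 h1, h2, fun v hv => ?_⟩
    simpa using h3 v hv
  have hvertex : ∀ k, k = i ∨ k = j → ∀ σ ∈ B,
      ∃ u : {v : V // {v} ∈ (link X (outer c {i, j} a.1)).faces}, u.1 ∈ σ.1 ∧ c u.1 = k := by
    intro k hk σ hσ
    obtain ⟨v, hv, hvk⟩ := hpart.exists_vertex σ.2 k
    refine ⟨⟨v, mem_link_of_mem σ.2 ((hB _).1 hσ) (by simpa using hv) (by simp) ?_⟩, hv, hvk⟩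
    simpa [hvk] using hk
  have hadj : ∀ σ ∈ B, ∀ u u' : {v : V // {v} ∈ (link X (outer c {i, j} a.1)).faces},
      u.1 ∈ σ.1 → u'.1 ∈ σ.1 → c u.1 = i → c u'.1 = j →
      (graph (link X (outer c {i, j} a.1))).Adj u u' := by
    intro σ hσ u u' hu hu' hi hj
    refine ⟨fun h => hij (hi.symm.trans ((congrArg (fun u => c u.1) h).trans hj)), ?_⟩
    refine mem_link_of_mem σ.2 ((hB _).1 hσ) (fun v hv => ?_) (by simp) fun v hv => ?_ <;>
      rcases Finset.mem_insert.1 hv with rfl | hv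
    · exact hu
    · rwa [Finset.mem_singleton.1 hv]
    · simp [hi]
    · simp [Finset.mem_singleton.1 hv, hj]
  have := Fintype.ofFinite {v : V // {v} ∈ (link X (outer c {i, j} a.1)).faces}
  have := hconn.nonempty
  choose! α hα hαi using hvertex i (Or.inl rfl)
  choose! β hβ hβj using hvertex j (Or.inr rfl)
  -- All chambers in `B` share their vertices of types other than `i` and `j`, so sharing the vertex
  -- of type `m` as well means sharing the panel opposite to type `k`.
  have houter : ∀ {k m : Fin (n + 1)}, ({i, j} : Finset (Fin (n + 1))) = {k, m} → ∀ σ ∈ B,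
      ∀ σ' ∈ B, ∀ v ∈ σ.1, v ∈ σ'.1 → c v = m → outer c {k} σ.1 = outer c {k} σ'.1 := by
    intro k m hkm σ hσ σ' hσ' v hv hv' hvm
    refine hpart.outer_eq σ'.2 σ.2 fun w hw => ?_
    obtain ⟨hw, hwk⟩ := mem_outer.1 hw
    by_cases hwm : c w = m
    · rwa [hpart.eq_of_type_eq σ'.2 hw hv' (hwm.trans hvm.symm)]
    · have : w ∈ outer c {i, j} σ'.1 := by
        rw [mem_outer, hkm]
        exact ⟨hw, by simpa [hwm] using hwk⟩
      rw [(hB σ').1 hσ', ← (hB σ).1 hσ] at this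
      exact outer_subset _ _ this
  -- Chambers in `B` are the edges of the link, with ends `α` of type `i` and `β` of type `j`.
  -- Constancy of `f` along panels opposite to type `i` means dependence on `β` alone, and `g`
  -- depends on `α` alone.
  refine two_mul_sum_edges_inner_le (s := {v | c v.1 = i}) hconn (α := α) (β := β) hαi
    (fun σ hσ h => hij ((h : c (β σ).1 = i).symm.trans (hβj σ hσ)))
    (fun σ hσ => hadj σ hσ _ _ (hα σ hσ) (hβ σ hσ) (hαi σ hσ) (hβj σ hσ)) ?_
    (link_bipartite hpure hpart a.2) ?_ ?_
    (fun r hr hr1 => (le_secondEigenvalue hr hr1).trans hle) ?_ ?_ hf0 hg0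
  · intro v u hvu hv
    obtain ⟨σ, hσ, hsub, htype⟩ := hexists _ hvu.2
    have hvσ : v.1 ∈ σ.1 := hsub (by simp)
    have huσ : u.1 ∈ σ.1 := hsub (by simp)
    have hu : c u.1 = j :=
      (htype u.1 (by simp)).resolve_left ((link_bipartite hpure hpart a.2 v u hvu).1 hv)
    exact ⟨σ, hσ,
      Subtype.ext (hpart.eq_of_type_eq σ.2 (hα σ hσ) hvσ ((hαi σ hσ).trans hv.symm)),
      Subtype.ext (hpart.eq_of_type_eq σ.2 (hβ σ hσ) huσ ((hβj σ hσ).trans hu.symm))⟩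
  · intro σ hσ σ' hσ' h1 h2
    have h3 := houter rfl σ hσ σ' hσ' _ (hβ σ hσ) (h2 ▸ hβ σ' hσ') (hβj σ hσ)
    refine Subtype.ext (Finset.eq_of_subset_of_card_le (fun v hv => ?_) ?_)
    · by_cases hvi : c v = i
      · rw [hpart.eq_of_type_eq σ.2 hv (hα σ hσ) (hvi.trans (hαi σ hσ).symm), h1]
        exact hα σ' hσ'
      · have : v ∈ outer c {i} σ.1 := mem_outer.2 ⟨hv, by simpa using hvi⟩
        rw [h3] at this
        exact outer_subset _ _ this
    · rw [card_of_mem_cells σ.2, card_of_mem_cells σ'.2]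
  · intro v
    obtain ⟨σ, hσ, hsub, htype⟩ := hexists _ v.2
    have hvσ : v.1 ∈ σ.1 := hsub (by simp)
    refine ⟨σ, hσ, (htype v.1 (by simp)).imp (fun hv => ?_) fun hv => ?_⟩
    · exact Subtype.ext (hpart.eq_of_type_eq σ.2 (hα σ hσ) hvσ ((hαi σ hσ).trans hv.symm))
    · exact Subtype.ext (hpart.eq_of_type_eq σ.2 (hβ σ hσ) hvσ ((hβj σ hσ).trans hv.symm))
  · exact fun σ hσ σ' hσ' h =>
      hf _ _ (houter rfl σ hσ σ' hσ' _ (hβ σ hσ) (h ▸ hβ σ' hσ') (hβj σ hσ))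
  · exact fun σ hσ σ' hσ' h =>
      hg _ _ (houter (Finset.pair_comm i j) σ hσ σ' hσ' _ (hα σ hσ) (h ▸ hα σ' hσ') (hαi σ hσ))

end Link

end Chambers

/-! ### Type-preserving actions on the chambers -/

section MassTransport

open MeasureTheory

variable {S C : Type*} [Group S] [MulAction S C]

theorem setOf_smul_mem_eq_biUnion [DecidableEq C] (s : Finset C) (b : C)
    [DecidablePred (· ∈ MulAction.orbit S b)] :
    {g : S | g • b ∈ s} = ⋃ c ∈ s.filter (· ∈ MulAction.orbit S b), {g : S | g • b = c} := by
  ext g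
  simp only [Set.mem_ofPred_eq, Finset.mem_filter, Set.mem_iUnion, exists_prop]
  exact ⟨fun h => ⟨_, ⟨h, MulAction.mem_orbit b g⟩, rfl⟩, fun ⟨_, h, h'⟩ => h' ▸ h.1⟩

/-- Mass transport on a unimodular group: weights inversely proportional to the measures of the
stabilizers are balanced. -/
theorem card_mul_measure_stabilizer [MeasurableSpace S] [MeasurableMul S] (ν : Measure S)
    [ν.IsMulLeftInvariant] [ν.IsMulRightInvariant]
    (hmeas : ∀ a : C, MeasurableSet (MulAction.stabilizer S a : Set S)) (p : InvPartition S C)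
    (a b : C) [DecidablePred (· ∈ MulAction.orbit S a)] [DecidablePred (· ∈ MulAction.orbit S b)] :
    ((p.cls a).filter (· ∈ MulAction.orbit S b)).card * ν (MulAction.stabilizer S b) =
      ((p.cls b).filter (· ∈ MulAction.orbit S a)).card * ν (MulAction.stabilizer S a) := by
  classical
  -- The measure of one set is computed twice: as a union of left cosets of the stabilizer of `b`,
  -- and, rewritten as the set where `g⁻¹ • a ∈ p.cls b`, of right cosets of the stabilizer of `a`.
  -- The second count needs right invariance.
  have h1 : ν {g : S | g • b ∈ p.cls a} =
      ((p.cls a).filter (· ∈ MulAction.orbit S b)).card * ν (MulAction.stabilizer S b) := by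
    have hc : ∀ c ∈ (p.cls a).filter (· ∈ MulAction.orbit S b),
        ∃ h : S, {g : S | g • b = c} = (h * ·) ⁻¹' (MulAction.stabilizer S b : Set S) := by
      intro c hc
      obtain ⟨-, h, rfl⟩ := Finset.mem_filter.1 hc
      refine ⟨h⁻¹, ?_⟩
      ext g
      simp [MulAction.mem_stabilizer_iff, mul_smul, inv_smul_eq_iff]
    rw [setOf_smul_mem_eq_biUnion, measure_biUnion_finset]
    · rw [Finset.sum_congr rfl fun c hcm => ?_, Finset.sum_const, nsmul_eq_mul]
      obtain ⟨h, hh⟩ := hc c hcm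
      rw [hh, measure_preimage_mul]
    · intro c _ c' _ hcc'
      exact Set.disjoint_left.2 fun g h h' => hcc' (h.symm.trans h')
    · intro c hcm
      obtain ⟨h, hh⟩ := hc c hcm
      rw [hh]
      exact (measurable_const_mul h) (hmeas b)
  have h2 : ν {g : S | g • b ∈ p.cls a} =
      ((p.cls b).filter (· ∈ MulAction.orbit S a)).card * ν (MulAction.stabilizer S a) := by
    have hset : {g : S | g • b ∈ p.cls a} =
        ⋃ c ∈ (p.cls b).filter (· ∈ MulAction.orbit S a), {g : S | g⁻¹ • a = c} := by
      ext g
      simp only [Set.mem_ofPred_eq, Finset.mem_filter, Set.mem_iUnion, exists_prop]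
      have key : g • b ∈ p.cls a ↔ g⁻¹ • a ∈ p.cls b := by
        rw [← p.smul_mem_iff g⁻¹, inv_smul_smul]
        exact ⟨p.mem_symm, p.mem_symm⟩
      rw [key]
      exact ⟨fun h => ⟨_, ⟨h, MulAction.mem_orbit a g⁻¹⟩, rfl⟩, fun ⟨_, h, h'⟩ => h' ▸ h.1⟩
    have hc : ∀ c ∈ (p.cls b).filter (· ∈ MulAction.orbit S a),
        ∃ h : S, {g : S | g⁻¹ • a = c} = (· * h) ⁻¹' (MulAction.stabilizer S a : Set S) := by
      intro c hc
      obtain ⟨-, h, rfl⟩ := Finset.mem_filter.1 hc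
      refine ⟨h, ?_⟩
      ext g
      simp only [Set.mem_ofPred_eq, Set.mem_preimage, SetLike.mem_coe,
        MulAction.mem_stabilizer_iff, mul_smul]
      rw [inv_smul_eq_iff, eq_comm]
    rw [hset, measure_biUnion_finset]
    · rw [Finset.sum_congr rfl fun c hcm => ?_, Finset.sum_const, nsmul_eq_mul]
      obtain ⟨h, hh⟩ := hc c hcm
      rw [hh, measure_preimage_mul_right]
    · intro c _ c' _ hcc'
      exact Set.disjoint_left.2 fun g h h' => hcc' (h.symm.trans h')
    · intro c hcm
      obtain ⟨h, hh⟩ := hc c hcm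
      rw [hh]
      exact (measurable_mul_const h) (hmeas a)
  rw [← h1, h2]

/-- The weighted domain with weights inversely proportional to the measures of the stabilizers. -/
noncomputable def haarDomain [MeasurableSpace S] (ν : Measure S) (D : Finset C)
    (hν : ∀ a : C, 0 < ν.real (MulAction.stabilizer S a : Set S))
    (hD : ∀ c, ∃ d ∈ D, ∃ g : S, g • d = c)
    (hD' : ∀ d ∈ D, ∀ d' ∈ D, ∀ g : S, g • d = d' → d = d') : WeightedDomain S C where
  reps := D
  weight a := (ν.real (MulAction.stabilizer S a : Set S))⁻¹
  weight_pos a := inv_pos.2 (hν a)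
  exists_smul := hD
  unique := hD'

theorem haarDomain_balanced [MeasurableSpace S] [MeasurableMul S] (ν : Measure S)
    [ν.IsMulLeftInvariant] [ν.IsMulRightInvariant] {D : Finset C}
    (hν : ∀ a : C, 0 < ν.real (MulAction.stabilizer S a : Set S))
    (hD : ∀ c, ∃ d ∈ D, ∃ g : S, g • d = c)
    (hD' : ∀ d ∈ D, ∀ d' ∈ D, ∀ g : S, g • d = d' → d = d')
    (hmeas : ∀ a : C, MeasurableSet (MulAction.stabilizer S a : Set S)) (p : InvPartition S C) :
    (haarDomain ν D hν hD hD').Balanced p := by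
  classical
  intro a b
  have h := congrArg ENNReal.toReal (card_mul_measure_stabilizer ν hmeas p a b)
  simp only [ENNReal.toReal_mul, ENNReal.toReal_natCast] at h
  change _ * ν.real _ = _ * ν.real _ at h
  have ha := (hν a).ne'
  have hb := (hν b).ne'
  change (ν.real _)⁻¹ * _ = (ν.real _)⁻¹ * _
  rw [inv_mul_eq_div, inv_mul_eq_div, div_eq_div_iff ha hb]
  exact h

end MassTransport

/-! ### Panels, residues and the displacement estimate for a type-preserving action -/

section Action

variable {V : Type*} [DecidableEq V] {X : PreAbstractSimplicialComplex V} {n : ℕ}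
  {c : V → Fin (n + 1)} {S : Type*} [Group S] [MulAction S V]

theorem ActsOn.smul_mem_cells (hact : ActsOn S X) (g : S) {σ : Finset V} {k : ℤ}
    (hσ : σ ∈ cells X k) : g • σ ∈ cells X k := by
  refine ⟨?_, by rw [Finset.card_smul_finset]; exact hσ.2⟩
  rcases hσ.1 with h | h
  · exact Or.inl (hact g σ h)
  · exact Or.inr (by rw [h, Finset.smul_finset_empty])

/-- The action on the chambers. -/
@[reducible] def ActsOn.chamberAction (hact : ActsOn S X) (n : ℕ) : MulAction S (cells X n) where
  smul g σ := ⟨g • σ.1, hact.smul_mem_cells g σ.2⟩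
  one_smul σ := Subtype.ext (one_smul S σ.1)
  mul_smul g h σ := Subtype.ext (mul_smul g h σ.1)

theorem ActsTypePreserving.type_smul (htype : ActsTypePreserving S X c) (g : S) {σ : Finset V}
    (hσ : σ ∈ X.faces) {v : V} (hv : v ∈ σ) : c (g • v) = c v := by
  have h := htype g {v} (mem_faces_of_subset hσ (Finset.singleton_subset_iff.2 hv)
    (Finset.singleton_nonempty v))
  rw [Finset.smul_finset_singleton, Finset.image_singleton, Finset.image_singleton,
    Finset.singleton_inj] at h
  exact h

theorem ActsTypePreserving.outer_smul (htype : ActsTypePreserving S X c) (g : S) {σ : Finset V}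
    (hσ : σ ∈ X.faces) (J : Finset (Fin (n + 1))) : outer c J (g • σ) = g • outer c J σ := by
  ext v
  simp only [mem_outer, Finset.mem_smul_finset]
  constructor
  · rintro ⟨⟨u, hu, rfl⟩, h⟩
    exact ⟨u, ⟨hu, by rwa [htype.type_smul g hσ hu] at h⟩, rfl⟩
  · rintro ⟨u, ⟨hu, h⟩, rfl⟩
    exact ⟨⟨u, hu, rfl⟩, by rwa [htype.type_smul g hσ hu]⟩

/-- The partition of the chambers by their vertices with types outside of `J`. -/
noncomputable def typePartition (hact : ActsOn S X) (htype : ActsTypePreserving S X c)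
    {J : Finset (Fin (n + 1))}
    (hfin : ∀ σ ∈ cells X n, {σ' | σ' ∈ cells X n ∧ outer c J σ' = outer c J σ}.Finite) :
    letI := hact.chamberAction n
    InvPartition S (cells X n) :=
  letI := hact.chamberAction n
  have hfin' : ∀ a : cells X n, {b : cells X n | outer c J b.1 = outer c J a.1}.Finite := fun a =>
    Set.Finite.of_finite_image ((hfin a.1 a.2).subset (by rintro _ ⟨b, hb, rfl⟩; exact ⟨b.2, hb⟩))
      Subtype.val_injective.injOn
  { cls := fun a => (hfin' a).toFinset
    self_mem := fun a => by simp
    cls_eq := fun {a b} h => by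
      ext x
      simp only [Set.Finite.mem_toFinset, Set.mem_ofPred_eq] at h ⊢
      rw [h]
    smul_mem := fun g {a b} h => by
      simp only [Set.Finite.mem_toFinset, Set.mem_ofPred_eq] at h ⊢
      exact (htype.outer_smul g (mem_faces_of_mem_cells b.2) J).trans ((congrArg (g • ·) h).trans
        (htype.outer_smul g (mem_faces_of_mem_cells a.2) J).symm) }

theorem mem_typePartition (hact : ActsOn S X) (htype : ActsTypePreserving S X c)
    {J : Finset (Fin (n + 1))}
    (hfin : ∀ σ ∈ cells X n, {σ' | σ' ∈ cells X n ∧ outer c J σ' = outer c J σ}.Finite)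
    (a b : cells X n) :
    letI := hact.chamberAction n
    b ∈ (typePartition hact htype hfin).cls a ↔ outer c J b.1 = outer c J a.1 := by
  simp [typePartition]

/-- This is what places in `kazhdanSet` the elements carrying one representative to a chamber that
shares a panel with another. -/
theorem card_inter_of_outer_eq (hpart : IsPartite X n c) {i : Fin (n + 1)} {σ σ' : Finset V}
    (hσ : σ ∈ cells X n) (h : outer c {i} σ' = outer c {i} σ) : n ≤ (σ' ∩ σ).card := by
  have h1 := hpart.card_outer {i} hσ
  rw [Finset.card_singleton] at h1
  have h2 : outer c {i} σ ⊆ σ' ∩ σ :=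
    Finset.subset_inter (by rw [← h]; exact outer_subset _ _) (outer_subset _ _)
  have := Finset.card_le_card h2
  omega

/-- Almost invariant vectors of a group that acts on a partite complex with small link
eigenvalues are close to invariant vectors. -/
theorem exists_invariant_norm_sub_le_of_linkMatrix [TopologicalSpace S] [IsTopologicalGroup S]
    [MeasurableSpace S] [BorelSpace S] (ν : MeasureTheory.Measure S) [ν.IsHaarMeasure]
    [ν.IsMulRightInvariant] (hpure : IsPure X n) (hpart : IsPartite X n c)
    (hgal : IsGalleryConnected X n) (hlink : HasFiniteConnectedLinks X n) (hact : ActsOn S X)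
    (htype : ActsTypePreserving S X c)
    (hstab : ∀ σ ∈ cells X n, IsOpen (MulAction.stabilizer S σ : Set S) ∧
      IsCompact (MulAction.stabilizer S σ : Set S))
    (hfin : ∀ i, ∀ σ ∈ cells X n,
      {σ' | σ' ∈ cells X n ∧ outer c {i} σ' = outer c {i} σ}.Finite)
    (hpos : (linkMatrix X n c).PosDef) {l : ℝ} (hl : 0 < l)
    (hA : ∀ d : Fin (n + 1) → ℝ,
      l * ∑ i, d i ^ 2 ≤ ∑ i, ∑ j, linkMatrix X n c i j * (d i * d j))
    {D : Set (Finset V)} (hDfin : D.Finite) (hD : IsFundamentalDomain S (cells X n) D)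
    {H : Type*} [NormedAddCommGroup H] [InnerProductSpace ℝ H] [CompleteSpace H]
    (π : S →* (H ≃ₗᵢ[ℝ] H)) {x : H} {δ : ℝ} (hδ : ∀ g ∈ kazhdanSet S n D, ‖π g x - x‖ ≤ δ) :
    ∃ z, (∀ g, π g z = z) ∧ ‖x - z‖ ≤ δ * (1 + √((n + 1) / l)) := by
  let _ := hact.chamberAction n
  have hsmul : ∀ (g : S) (a : cells X n), (g • a).1 = g • a.1 := fun _ _ => rfl
  have hst : ∀ a : cells X n, MulAction.stabilizer S a = MulAction.stabilizer S a.1 := by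
    intro a; ext g
    simp only [MulAction.mem_stabilizer_iff, Subtype.ext_iff, hsmul]
  have hDC : ∀ τ ∈ D, τ ∈ cells X n := fun τ hτ => hD.1 hτ
  let DC : Finset (cells X n) :=
    (Set.Finite.preimage (f := Subtype.val) Subtype.val_injective.injOn hDfin).toFinset
  have hDCmem : ∀ a : cells X n, a ∈ DC ↔ a.1 ∈ D := fun a => by simp [DC]
  have hν : ∀ a : cells X n, 0 < ν.real (MulAction.stabilizer S a : Set S) := by
    intro a
    rw [hst]
    obtain ⟨ho, hc⟩ := hstab a.1 a.2
    exact ENNReal.toReal_pos (ho.measure_pos ν ⟨1, Subgroup.one_mem _⟩).ne' hc.measure_lt_top.ne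
  have hmeas : ∀ a : cells X n, MeasurableSet (MulAction.stabilizer S a : Set S) := fun a => by
    rw [hst]; exact (hstab a.1 a.2).1.measurableSet
  have hD1 : ∀ a : cells X n, ∃ d ∈ DC, ∃ g : S, g • d = a := by
    intro a
    obtain ⟨σ, ⟨hσ, g, hg⟩, -⟩ := hD.2 a.1 a.2
    exact ⟨⟨σ, hDC σ hσ⟩, (hDCmem _).2 hσ, g, Subtype.ext hg⟩
  have hD2 : ∀ d ∈ DC, ∀ d' ∈ DC, ∀ g : S, g • d = d' → d = d' := by
    intro d hd d' hd' g hg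
    refine Subtype.ext ((hD.2 d'.1 d'.2).unique ⟨(hDCmem _).1 hd, g, ?_⟩
      ⟨(hDCmem _).1 hd', 1, one_smul _ _⟩)
    rw [← hsmul, hg]
  obtain ⟨σ₁, hσ₁⟩ := hpure.2.1
  obtain ⟨d₁, hd₁, -⟩ := hD1 ⟨σ₁, hσ₁⟩
  classical
  -- Only pairs `i ≠ j` matter; the diagonal value is a filler that makes the family of partitions
  -- total.
  have hfin2 : ∀ i j : Fin (n + 1), ∀ σ ∈ cells X n,
      {σ' | σ' ∈ cells X n ∧ outer c (if i = j then {i} else {i, j}) σ' =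
        outer c (if i = j then {i} else {i, j}) σ}.Finite := by
    intro i j σ hσ
    split_ifs with hij
    · exact hfin i σ hσ
    · exact hpart.finite_outer_eq hlink hij hσ
  let p : Fin (n + 1) → InvPartition S (cells X n) := fun i => typePartition hact htype (hfin i)
  let q : Fin (n + 1) → Fin (n + 1) → InvPartition S (cells X n) := fun i j =>
    typePartition hact htype (hfin2 i j)
  have hp : ∀ i a b, b ∈ (p i).cls a ↔ outer c {i} b.1 = outer c {i} a.1 := fun i a b =>
    mem_typePartition hact htype (hfin i) a b
  have hq : ∀ i j, i ≠ j → ∀ a b, b ∈ (q i j).cls a ↔ outer c {i, j} b.1 = outer c {i, j} a.1 :=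
    fun i j hij a b => (mem_typePartition hact htype (hfin2 i j) a b).trans (by rw [if_neg hij])
  have hoff : ∀ i j, i ≠ j → -linkMatrix X n c i j = linkLambda X n c i j := fun i j hij => by
    simp [linkMatrix, hij]
  have main := exists_invariant_norm_sub_le π (haarDomain ν DC hν hD1 hD2) ⟨d₁, hd₁⟩ p q
    (fun i => haarDomain_balanced ν hν hD1 hD2 hmeas _)
    (fun i j _ => haarDomain_balanced ν hν hD1 hD2 hmeas _)
    (fun i j hij a b hb => (hq i j hij a b).2
      (outer_eq_of_subset (by simp) ((hp i a b).1 hb)))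
    (fun i j hij a b hb => (hq i j hij a b).2
      (outer_eq_of_subset (by simp) ((hp j a b).1 hb)))
    hl hA (fun i => by simp [linkMatrix])
    (fun i j hij => by rw [hoff i j hij]; exact linkLambda_mem_Ico hpure hpart hpos hij)
    (fun i j hij f g hf hg hf0 hg0 a => by
      rw [hoff i j hij]
      exact two_mul_sum_inner_le hpure hpart hlink hij a _ (hq i j hij a)
        (fun a b h => hf a b ((hp i a b).2 h)) (fun a b h => hg a b ((hp j a b).2 h))
        (hf0 a) (hg0 a))
    (fun φ hφ => hgal.eq_of_outer_eq hpart fun i a b h => hφ i a b ((hp i a b).2 h))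
    (x := x) (δ := δ) (fun d hd i d' hd' g hg => hδ g ⟨d.1, (hDCmem d).1 hd, d'.1,
      (hDCmem d').1 hd', card_inter_of_outer_eq hpart d.2 ((hp i d _).1 hg)⟩)
  obtain ⟨z, hz, hle⟩ := main
  refine ⟨z, hz, ?_⟩
  simpa using hle

end Action

/-- The smallest eigenvalue of a positive definite real matrix. -/
theorem exists_isLeast_eigenvalue {ι : Type*} [Fintype ι] [DecidableEq ι] [Nonempty ι]
    {A : Matrix ι ι ℝ} (hA : A.PosDef) :
    ∃ l : ℝ, 0 < l ∧ IsLeast {r : ℝ | Module.End.HasEigenvalue (Matrix.toLin' A) r} l ∧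
      ∀ d : ι → ℝ, l * ∑ i, d i ^ 2 ≤ ∑ i, ∑ j, A i j * (d i * d j) := by
  have hh := hA.isHermitian
  have hset : ∀ r, Module.End.HasEigenvalue (Matrix.toLin' A) r ↔ r ∈ Set.range hh.eigenvalues :=
    fun r => by
      rw [Module.End.hasEigenvalue_iff_mem_spectrum, Matrix.spectrum_toLin',
        hh.spectrum_real_eq_range_eigenvalues]
  obtain ⟨i₀, hi₀⟩ := Finite.exists_min hh.eigenvalues
  have hleast : ∀ r, Module.End.HasEigenvalue (Matrix.toLin' A) r → hh.eigenvalues i₀ ≤ r := by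
    intro r hr
    obtain ⟨i, rfl⟩ := (hset r).1 hr
    exact hi₀ i
  refine ⟨hh.eigenvalues i₀, hA.eigenvalues_pos i₀, ⟨(hset _).2 ⟨i₀, rfl⟩, hleast⟩, ?_⟩
  generalize hh.eigenvalues i₀ = l at hleast
  have hN : (A - l • (1 : Matrix ι ι ℝ)).IsHermitian :=
    hh.sub (by simp [Matrix.IsHermitian])
  -- Adding `l` to an eigenvalue of `A - l • 1` gives an eigenvalue of `A`, which is at least `l`.
  have hpsd : (A - l • (1 : Matrix ι ι ℝ)).PosSemidef := by
    rw [hN.posSemidef_iff_eigenvalues_nonneg]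
    intro k
    have h1 := hN.mulVec_eigenvectorBasis k
    rw [Matrix.sub_mulVec, Matrix.smul_mulVec, Matrix.one_mulVec, sub_eq_iff_eq_add,
      ← add_smul] at h1
    have h2 : Module.End.HasEigenvalue (Matrix.toLin' A) (hN.eigenvalues k + l) := by
      refine Module.End.hasEigenvalue_of_hasEigenvector
        (x := (hN.eigenvectorBasis k).ofLp) ⟨?_, fun h0 => ?_⟩
      · rw [Module.End.mem_eigenspace_iff, Matrix.toLin'_apply]
        exact h1
      · have h3 := hN.eigenvectorBasis.orthonormal.1 k
        have h4 : hN.eigenvectorBasis k = 0 := by ext v; exact congrFun h0 v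
        rw [h4, norm_zero] at h3
        exact zero_ne_one h3
    have := hleast _ h2
    change 0 ≤ hN.eigenvalues k
    linarith
  intro d
  have h := hpsd.dotProduct_mulVec_nonneg d
  rw [star_trivial, Matrix.sub_mulVec, Matrix.smul_mulVec, Matrix.one_mulVec, dotProduct_sub,
    dotProduct_smul, sub_nonneg] at h
  simp only [dotProduct, Matrix.mulVec, smul_eq_mul, Finset.mul_sum] at h ⊢
  refine (le_of_eq ?_).trans (h.trans_eq ?_)
  · exact Finset.sum_congr rfl fun i _ => by ring
  · exact Finset.sum_congr rfl fun i _ => Finset.sum_congr rfl fun j _ => by ring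

/-! ### Unimodularity, compactness and local finiteness -/

section Topology

variable {G : Type*} [Group G] [TopologicalSpace G] [IsTopologicalGroup G]

-- A right translate of Haar measure is again left invariant and regular, hence a multiple of it,
-- and the factor is the modular character.
open MeasureTheory Measure in
theorem IsUnimodular.isMulRightInvariant_haar [LocallyCompactSpace G] [MeasurableSpace G]
    [BorelSpace G] (h : IsUnimodular G) : (haar : Measure G).IsMulRightInvariant := by
  constructor
  intro g
  have : Regular (map (· * g) (haar : Measure G)) := Regular.map (Homeomorph.mulRight g)
  rw [isMulLeftInvariant_eq_smul_of_regular (map (· * g) haar) haar,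
    ← modularCharacterFun_eq_haarScalarFactor]
  have h1 : modularCharacterFun g = 1 := h g
  rw [h1, one_smul]

variable {V : Type*} [DecidableEq V] {X : PreAbstractSimplicialComplex V} {n : ℕ}
  {c : V → Fin (n + 1)} [MulAction G V]

theorem isCompact_setOf_smul_eq {τ τ' : Finset V}
    (h : IsCompact (MulAction.stabilizer G τ' : Set G)) : IsCompact {g : G | g • τ' = τ} := by
  rcases Set.eq_empty_or_nonempty {g : G | g • τ' = τ} with h0 | ⟨g₀, rfl⟩
  · rw [h0]; exact isCompact_empty
  · have : {g : G | g • τ' = g₀ • τ'} = (g₀ * ·) '' (MulAction.stabilizer G τ' : Set G) := by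
      ext g
      simp only [Set.mem_ofPred_eq, Set.mem_image, SetLike.mem_coe, MulAction.mem_stabilizer_iff]
      constructor
      · exact fun h => ⟨g₀⁻¹ * g, by rw [mul_smul, h, inv_smul_smul], by group⟩
      · rintro ⟨s, hs, rfl⟩
        rw [mul_smul, hs]
    rw [this]
    exact h.image (continuous_const_mul g₀)

/-- Membership means that `g` carries a face with `n` vertices of some member of `D` onto such a
face of another. So the set is a finite union of sets that are empty or cosets of compact panel
stabilizers. -/
theorem isCompact_kazhdanSet {D : Set (Finset V)} (hD : D.Finite) (hDX : D ⊆ cells X n)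
    (hstab : ∀ τ ∈ cells X ((n : ℤ) - 1), IsCompact (MulAction.stabilizer G τ : Set G)) :
    IsCompact (kazhdanSet G n D) := by
  have : kazhdanSet G n D = ⋃ σ ∈ D, ⋃ σ' ∈ D, ⋃ τ ∈ σ.powersetCard n, ⋃ τ' ∈ σ'.powersetCard n,
      {g : G | g • τ' = τ} := by
    ext g
    simp only [kazhdanSet, Set.mem_ofPred_eq, Set.mem_iUnion, exists_prop,
      Finset.mem_powersetCard]
    refine exists_congr fun σ => and_congr_right fun _ => exists_congr fun σ' =>
      and_congr_right fun _ => ?_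
    constructor
    · intro h
      obtain ⟨τ, hτ, hcard⟩ := Finset.exists_subset_card_eq h
      obtain ⟨h1, h2⟩ := Finset.subset_inter_iff.1 hτ
      refine ⟨τ, ⟨h2, hcard⟩, g⁻¹ • τ, ⟨?_, by rw [Finset.card_smul_finset, hcard]⟩,
        smul_inv_smul g τ⟩
      rw [← Finset.smul_finset_subset_smul_finset_iff (a := g), smul_inv_smul]
      exact h1
    · rintro ⟨τ, ⟨hτ, hcard⟩, τ', ⟨hτ', -⟩, rfl⟩
      rw [← hcard]
      exact Finset.card_le_card
        (Finset.subset_inter (Finset.smul_finset_subset_smul_finset hτ') hτ)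
  rw [this]
  refine hD.isCompact_biUnion fun σ _ => hD.isCompact_biUnion fun σ' hσ' =>
    Finset.isCompact_biUnion _ fun τ _ => Finset.isCompact_biUnion _ fun τ' hτ' => ?_
  obtain ⟨h1, h2⟩ := Finset.mem_powersetCard.1 hτ'
  exact isCompact_setOf_smul_eq (hstab τ' (mem_cells_of_subset (hDX hσ') h1 (by omega)))

/-- In dimension 0 no codimension-two links are available. Here the panel is the empty simplex, with
stabilizer `G`, so `G` is compact; open stabilizers then have finite orbits, and there are finitely
many orbits. -/
theorem finite_cells_zero {X : PreAbstractSimplicialComplex V} (hcocompact : ActsCocompactly G X)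
    (hG : IsCompact (Set.univ : Set G))
    (hstab : ∀ τ ∈ cells X (0 : ℕ), IsOpen (MulAction.stabilizer G τ : Set G))
    (hact : ActsOn G X) : (cells X (0 : ℕ)).Finite := by
  have : CompactSpace G := ⟨hG⟩
  obtain ⟨F, hF, -, hF'⟩ := hcocompact
  refine (((hF.inter_of_left (cells X (0 : ℕ))).biUnion (t := fun σ => MulAction.orbit G σ)
    fun σ hσ => ?_)).subset fun τ hτ => ?_
  · have := Subgroup.quotient_finite_of_isOpen _ (hstab σ hσ.2)
    have := Finite.of_equiv _ (MulAction.orbitEquivQuotientStabilizer G σ).symm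
    exact Set.toFinite _
  · obtain ⟨σ, hσ, g, rfl⟩ := hF' τ (mem_faces_of_mem_cells hτ)
    have h := hact.smul_mem_cells g⁻¹ hτ
    rw [inv_smul_smul] at h
    exact Set.mem_biUnion ⟨hσ, h⟩ ⟨g, rfl⟩

/-- Only finitely many chambers contain a given panel. -/
theorem finite_panel (hpart : IsPartite X n c) (hlink : HasFiniteConnectedLinks X n)
    (hact : ActsOn G X) (hcocompact : ActsCocompactly G X)
    (hopen : ∀ τ ∈ cells X n, IsOpen (MulAction.stabilizer G τ : Set G))
    (hcompact : ∀ τ ∈ cells X ((n : ℤ) - 1), IsCompact (MulAction.stabilizer G τ : Set G))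
    (i : Fin (n + 1)) {σ : Finset V} (hσ : σ ∈ cells X n) :
    {σ' | σ' ∈ cells X n ∧ outer c {i} σ' = outer c {i} σ}.Finite := by
  rcases Nat.eq_zero_or_pos n with rfl | hn
  · refine (finite_cells_zero hcocompact ?_ hopen hact).subset fun σ' h => h.1
    have h := hcompact ∅ ⟨Or.inr rfl, by simp⟩
    convert h
    ext g
    simp
  · obtain ⟨j, hj⟩ : ∃ j, i ≠ j := by
      have : Nontrivial (Fin (n + 1)) := Fin.nontrivial_iff_two_le.2 (by omega)
      obtain ⟨j, hj⟩ := exists_ne i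
      exact ⟨j, hj.symm⟩
    exact (hpart.finite_outer_eq hlink hj hσ).subset fun σ' h =>
      ⟨h.1, outer_eq_of_subset (by simp) h.2⟩

theorem isOpen_isCompact_stabilizer_subgroup {S : Subgroup G} (hS : IsOpen (S : Set G))
    {τ : Finset V} (ho : IsOpen (MulAction.stabilizer G τ : Set G))
    (hc : IsCompact (MulAction.stabilizer G τ : Set G)) :
    IsOpen (MulAction.stabilizer S τ : Set S) ∧ IsCompact (MulAction.stabilizer S τ : Set S) := by
  have h : (MulAction.stabilizer S τ : Set S) =
      Subtype.val ⁻¹' (MulAction.stabilizer G τ : Set G) := rfl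
  rw [h]
  exact ⟨ho.preimage continuous_subtype_val,
    (S.isClosed_of_isOpen hS).isClosedEmbedding_subtypeVal.isCompact_preimage hc⟩

end Topology

/-! ### Fundamental domains and passage to finite index -/

section FundamentalDomain

variable {V : Type*} [DecidableEq V] {X : PreAbstractSimplicialComplex V} {n : ℕ}
  {c : V → Fin (n + 1)} {G : Type*} [Group G] [MulAction G V]

theorem exists_isFundamentalDomain (hact : ActsOn G X) (k : ℤ) :
    ∃ D, IsFundamentalDomain G (cells X k) D := by
  let r : Finset V → Finset V := fun τ => (Quotient.mk (MulAction.orbitRel G (Finset V)) τ).out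
  have hr : ∀ τ, r τ ∈ MulAction.orbit G τ := fun τ => Quotient.mk_out (s := MulAction.orbitRel G _) τ
  have hr' : ∀ (g : G) τ, r (g • τ) = r τ := fun g τ => by
    refine congrArg Quotient.out (Quotient.sound (s := MulAction.orbitRel G _) ?_)
    exact MulAction.mem_orbit τ g
  refine ⟨{τ | τ ∈ cells X k ∧ r τ = τ}, fun τ h => h.1, fun σ hσ => ⟨r σ, ⟨⟨?_, ?_⟩, ?_⟩, ?_⟩⟩
  · obtain ⟨g, hg⟩ := hr σ
    rw [← hg]; exact hact.smul_mem_cells g hσ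
  · obtain ⟨g, hg⟩ := hr σ
    conv_lhs => rw [← hg]
    exact hr' g σ
  · obtain ⟨g, hg⟩ := hr σ
    exact ⟨g⁻¹, by rw [← hg]; exact inv_smul_smul g σ⟩
  · rintro τ ⟨⟨-, hτ⟩, g, rfl⟩
    rw [hr', hτ]

theorem IsFundamentalDomain.finite {C D F : Set (Finset V)} (hD : IsFundamentalDomain G C D)
    (hF : F.Finite) (h : ∀ σ ∈ C, ∃ τ ∈ F, ∃ g : G, g • τ = σ) : D.Finite := by
  choose! f hf g hg using h
  refine Set.Finite.of_injOn (f := f) (fun σ hσ => hf σ (hD.1 hσ)) (fun σ hσ σ' hσ' he => ?_) hF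
  refine (hD.2 σ' (hD.1 hσ')).unique ⟨hσ, g σ' * (g σ)⁻¹, ?_⟩ ⟨hσ', 1, one_smul _ _⟩
  rw [mul_smul, inv_smul_eq_iff.2 (hg σ (hD.1 hσ)).symm, he, hg σ' (hD.1 hσ')]

/-- Inverses of left coset representatives represent the right cosets of `S`, so their finitely many
translates of `F` meet every `S`-orbit. -/
theorem IsFundamentalDomain.finite_of_finiteIndex {S : Subgroup G} [S.FiniteIndex]
    (hcocompact : ActsCocompactly G X) {D : Set (Finset V)}
    (hD : IsFundamentalDomain S (cells X n) D) : D.Finite := by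
  obtain ⟨F, hF, -, hF'⟩ := hcocompact
  have hT : (Set.range fun q : G ⧸ S => q.out⁻¹).Finite := Set.finite_range _
  refine hD.finite (F := Set.image2 (fun t σ => t • σ) _ F) (hT.image2 _ hF) fun σ hσ => ?_
  obtain ⟨τ, hτ, g, rfl⟩ := hF' σ (mem_faces_of_mem_cells hσ)
  obtain ⟨s, hs⟩ := QuotientGroup.mk_out_eq_mul S g⁻¹
  refine ⟨_, ⟨_, ⟨(g⁻¹ : G), rfl⟩, τ, hτ, rfl⟩, s, ?_⟩
  change s.1 • ((g⁻¹ : G) : G ⧸ S).out⁻¹ • τ = g • τ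
  rw [hs, smul_smul]
  congr 1
  group

end FundamentalDomain

/-! ### The permutation action on types -/

section Types

variable {V : Type*} [DecidableEq V] {X : PreAbstractSimplicialComplex V} {n : ℕ}
  {c : V → Fin (n + 1)} {G : Type*} [Group G] [MulAction G V]

/-- For types: a shared panel fixes the images of all types but one, and injectivity leaves a single
choice for the last. -/
theorem eq_of_injective_of_eq_of_ne {α : Type*} [Finite α] {f f' : α → α}
    (hf : Function.Injective f) (hf' : Function.Injective f') {i : α}
    (h : ∀ k, k ≠ i → f k = f' k) : f = f' := by
  funext m
  by_cases hm : m = i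
  · subst hm
    obtain ⟨k, hk⟩ := Finite.surjective_of_injective hf (f' m)
    by_cases hkm : k = m
    · rw [← hkm, hk, hkm]
    · rw [h k hkm] at hk
      exact absurd (hf' hk) hkm
  · exact h m hm

/-- An automorphism of a gallery connected partite complex permutes the types. -/
theorem exists_type_map (hpart : IsPartite X n c) (hgal : IsGalleryConnected X n)
    (hne : (cells X n).Nonempty) (hact : ActsOn G X) (g : G) :
    ∃ t : Fin (n + 1) → Fin (n + 1), ∀ σ ∈ cells X n, ∀ v ∈ σ, c (g • v) = t (c v) := by
  choose p hp hpc using fun (σ : cells X n) i => hpart.exists_vertex σ.2 i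
  have hinj : ∀ σ : cells X n, Function.Injective fun i => c (g • p σ i) := by
    intro σ i k hik
    have h := hpart.eq_of_type_eq (hact.smul_mem_cells g σ.2)
      (Finset.smul_mem_smul_finset (hp σ i)) (Finset.smul_mem_smul_finset (hp σ k)) hik
    rw [← hpc σ i, ← hpc σ k, MulAction.injective g h]
  obtain ⟨σ₀, hσ₀⟩ := hne
  refine ⟨fun i => c (g • p ⟨σ₀, hσ₀⟩ i), fun σ hσ v hv => ?_⟩
  -- The type permutation that `g` induces on a chamber is the same for chambers sharing a panel,
  -- hence the same for all.
  have h := hgal.eq_of_outer_eq hpart (φ := fun σ i => c (g • p σ i)) (fun i a b hab => by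
    refine eq_of_injective_of_eq_of_ne (i := i) (hinj b) (hinj a) fun k hk => ?_
    have h1 : p b k ∈ outer c {i} b.1 := mem_outer.2 ⟨hp b k, by simpa [hpc] using hk⟩
    rw [hab] at h1
    rw [hpart.eq_of_type_eq a.2 (outer_subset _ _ h1) (hp a k) ((hpc b k).trans (hpc a k).symm)])
    ⟨σ₀, hσ₀⟩ ⟨σ, hσ⟩
  have hv' : p ⟨σ, hσ⟩ (c v) = v := hpart.eq_of_type_eq hσ (hp ⟨σ, hσ⟩ (c v)) hv (hpc _ _)
  refine Eq.trans ?_ (congrFun h (c v)).symm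
  exact congrArg (fun u => c (g • u)) hv'.symm

/-- The action on the types. -/
theorem exists_type_hom (hpart : IsPartite X n c) (hgal : IsGalleryConnected X n)
    (hne : (cells X n).Nonempty) (hact : ActsOn G X) :
    ∃ θ : G →* Equiv.Perm (Fin (n + 1)),
      ∀ g, ∀ σ ∈ cells X n, ∀ v ∈ σ, c (g • v) = θ g (c v) := by
  choose t ht using exists_type_map hpart hgal hne hact
  obtain ⟨σ₀, hσ₀⟩ := hne
  let _ : MulAction G (Fin (n + 1)) :=
    { smul := t
      one_smul := fun i => by
        obtain ⟨v, hv, rfl⟩ := hpart.exists_vertex hσ₀ i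
        change t 1 (c v) = c v
        rw [← ht 1 σ₀ hσ₀ v hv, one_smul]
      mul_smul := fun g h i => by
        obtain ⟨v, hv, rfl⟩ := hpart.exists_vertex hσ₀ i
        change t (g * h) (c v) = t g (t h (c v))
        rw [← ht _ σ₀ hσ₀ v hv, ← ht _ σ₀ hσ₀ v hv,
          ← ht g _ (hact.smul_mem_cells h hσ₀) _ (Finset.smul_mem_smul_finset hv), mul_smul] }
  exact ⟨MulAction.toPermHom G (Fin (n + 1)), ht⟩

/-- The type-preserving automorphisms contain an open subgroup of finite index. -/
theorem exists_typePreserving_subgroup [TopologicalSpace G] [IsTopologicalGroup G]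
    (hpure : IsPure X n) (hpart : IsPartite X n c) (hgal : IsGalleryConnected X n)
    (hact : ActsOn G X)
    (hopen : ∀ τ ∈ cells X n, IsOpen (MulAction.stabilizer G τ : Set G))
    (hopen' : ∀ τ ∈ cells X ((n : ℤ) - 1), IsOpen (MulAction.stabilizer G τ : Set G)) :
    ∃ S : Subgroup G, IsOpen (S : Set G) ∧ S.FiniteIndex ∧ ActsTypePreserving S X c := by
  obtain ⟨θ, hθ⟩ := exists_type_hom hpart hgal hpure.2.1 hact
  refine ⟨θ.ker, ?_, inferInstance, ?_⟩
  · obtain ⟨σ₀, hσ₀⟩ := hpure.2.1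
    -- An element preserving `σ₀` and each of its panels fixes each vertex of `σ₀`, hence all types.
    -- Only stabilizers of chambers and panels are known to be open, so vertices are reached through
    -- their opposite panels.
    have hU : IsOpen ((MulAction.stabilizer G σ₀ : Set G) ∩
        ⋂ v ∈ σ₀, (MulAction.stabilizer G (σ₀.erase v) : Set G)) := by
      refine (hopen σ₀ hσ₀).inter (isOpen_biInter_finset fun v hv => hopen' _ ?_)
      refine mem_cells_of_subset hσ₀ (Finset.erase_subset _ _) ?_
      have h1 := Finset.card_erase_of_mem hv
      have h2 := card_of_mem_cells hσ₀
      omega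
    refine Subgroup.isOpen_of_mem_nhds _ (g := 1) (Filter.mem_of_superset
      (hU.mem_nhds (by simp)) ?_)
    rintro g ⟨hg, hg'⟩
    rw [SetLike.mem_coe, MonoidHom.mem_ker]
    ext i : 1
    obtain ⟨v, hv, rfl⟩ := hpart.exists_vertex hσ₀ i
    rw [← hθ g σ₀ hσ₀ v hv, Equiv.Perm.one_apply]
    have h1 : g • v ∈ σ₀ := by
      rw [← MulAction.mem_stabilizer_iff.1 hg]; exact Finset.smul_mem_smul_finset hv
    have h2 : g • v ∉ σ₀.erase v := by
      have h3 : g • σ₀.erase v = σ₀.erase v := Set.mem_iInter₂.1 hg' v hv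
      rw [← h3, Finset.smul_mem_smul_finset_iff]
      exact Finset.notMem_erase v σ₀
    by_contra h3
    exact h2 (Finset.mem_erase.2 ⟨fun h => h3 (congrArg c h), h1⟩)
  · intro g τ hτ
    obtain ⟨σ, hσ, hsub⟩ := hpure.2.2 τ hτ
    change (g.1 • τ).image c = τ.image c
    rw [Finset.smul_finset_def, Finset.image_image]
    refine Finset.image_congr fun v hv => ?_
    have hg : θ g.1 = 1 := g.2
    rw [Function.comp_apply, hθ g.1 σ hσ v (hsub hv), hg, Equiv.Perm.one_apply]

end Types

/-! ### Unitary representations and finite-index subgroups -/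

section Representations

variable {G : Type*} [Group G] {H : Type*} [NormedAddCommGroup H] [InnerProductSpace ℂ H]

/-- A complex unitary representation, as a real orthogonal one. -/
noncomputable def realRep (π : G →* (H ≃ₗᵢ[ℂ] H)) : G →* (H ≃ₗᵢ[ℝ] H) where
  toFun g := { (π g).toLinearEquiv.restrictScalars ℝ with norm_map' := (π g).norm_map }
  map_one' := by ext x; exact congrArg (fun f : H ≃ₗᵢ[ℂ] H => f x) (map_one π)
  map_mul' g h := by ext x; exact congrArg (fun f : H ≃ₗᵢ[ℂ] H => f x) (map_mul π g h)

theorem norm_sub_le_iSup (π : G →* (H ≃ₗᵢ[ℂ] H)) (K : Set G) (x : H) {g : G} (hg : g ∈ K) :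
    ‖π g x - x‖ ≤ ⨆ g : K, ‖π g x - x‖ := by
  -- The bound `2 * ‖x‖` is needed because an unbounded real supremum would take the value 0.
  refine le_ciSup (f := fun g : K => ‖π g x - x‖) ⟨2 * ‖x‖, ?_⟩ ⟨g, hg⟩
  rintro _ ⟨g, rfl⟩
  refine (norm_sub_le _ _).trans ?_
  rw [LinearIsometryEquiv.norm_map]; linarith

/-- A vector that is close to a vector invariant under a subgroup of finite index, and almost
invariant under coset representatives, is small if there are no invariant vectors. -/
theorem norm_le_of_finiteIndex (π : G →* (H ≃ₗᵢ[ℂ] H)) (hinv : ∀ x : H, (∀ g, π g x = x) → x = 0)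
    (S : Subgroup G) [S.FiniteIndex] {x z : H} (hz : ∀ s ∈ S, π s z = z) {δ : ℝ}
    (hδ : ∀ q : G ⧸ S, ‖π q.out x - x‖ ≤ δ) : ‖x‖ ≤ δ + ‖x - z‖ := by
  have := Fintype.ofFinite (G ⧸ S)
  -- The sum of the translates of `z` over the cosets is independent of representatives and thus
  -- `G`-invariant. It vanishes, so `x` is the mean of the vectors `x - π q.out z`.
  have hsum : ∑ q : G ⧸ S, π q.out z = 0 := by
    refine hinv _ fun g => ?_
    rw [map_sum]
    refine Fintype.sum_equiv (MulAction.toPerm g) _ _ fun q => ?_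
    have h1 : ((g * q.out : G) : G ⧸ S) = g • q := by
      rw [← smul_eq_mul, ← MulAction.Quotient.smul_coe, QuotientGroup.out_eq']
    obtain ⟨s, hs⟩ := QuotientGroup.mk_out_eq_mul S (g * q.out)
    rw [h1] at hs
    change π g (π q.out z) = π (g • q).out z
    rw [hs, map_mul, map_mul]
    change _ = π g (π q.out (π s z))
    rw [hz s.1 s.2]
  have hN : (0 : ℝ) < Fintype.card (G ⧸ S) := by exact_mod_cast Fintype.card_pos
  have hbound : ‖∑ q : G ⧸ S, (x - π q.out z)‖ ≤ Fintype.card (G ⧸ S) * (δ + ‖x - z‖) := by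
    rw [← nsmul_eq_mul, ← Finset.card_univ]
    refine (norm_sum_le _ _).trans (Finset.sum_le_card_nsmul _ _ _ fun q _ => ?_)
    calc ‖x - π q.out z‖ ≤ ‖x - π q.out x‖ + ‖π q.out x - π q.out z‖ :=
          norm_sub_le_norm_sub_add_norm_sub _ _ _
      _ ≤ δ + ‖x - z‖ := by
          rw [← map_sub, LinearIsometryEquiv.norm_map, norm_sub_rev]
          exact add_le_add_left (hδ q) _
  rw [Finset.sum_sub_distrib, hsum, sub_zero, Finset.sum_const, Finset.card_univ,
    ← Nat.cast_smul_eq_nsmul ℝ, norm_smul, Real.norm_natCast] at hbound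
  exact le_of_mul_le_mul_left hbound hN

end Representations

end PartiteT

/-! ### Property (T) and the explicit Kazhdan pair -/

open MeasureTheory in
theorem theorem3p6 {V : Type v} [DecidableEq V] (n : ℕ)
    (X : PreAbstractSimplicialComplex V) (c : V → Fin (n + 1))
    (hpure : PartiteT.IsPure X n)
    (hpart : PartiteT.IsPartite X n c)
    (hgal : PartiteT.IsGalleryConnected X n)
    (hlink : PartiteT.HasFiniteConnectedLinks X n)
    (G : Type u) [Group G] [TopologicalSpace G] [IsTopologicalGroup G] [LocallyCompactSpace G]
    (huni : PartiteT.IsUnimodular G)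
    [MulAction G V]
    (hact : PartiteT.ActsOn G X)
    (hcocompact : PartiteT.ActsCocompactly G X)
    (hstab : ∀ τ ∈ PartiteT.cells X ((n : ℤ) - 2) ∪ PartiteT.cells X ((n : ℤ) - 1) ∪
        PartiteT.cells X n,
      IsOpen (MulAction.stabilizer G τ : Set G) ∧ IsCompact (MulAction.stabilizer G τ : Set G))
    (hpos : (PartiteT.linkMatrix X n c).PosDef) :
    PartiteT.HasPropertyT.{u, w} G ∧
    (PartiteT.ActsTypePreserving G X c →
      ∃ lam : ℝ, 0 < lam ∧
        IsLeast {r : ℝ | Module.End.HasEigenvalue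
          (Matrix.toLin' (PartiteT.linkMatrix X n c)) r} lam ∧
        ∀ D : Set (Finset V), PartiteT.IsFundamentalDomain G (PartiteT.cells X n) D →
          IsCompact (PartiteT.kazhdanSet G n D) ∧
          PartiteT.IsKazhdanPair.{u, w} G (PartiteT.kazhdanSet G n D)
            (1 / (2 * (1 + Real.sqrt (((n : ℝ) + 1) / lam))))) := by
  borelize G
  have hright := huni.isMulRightInvariant_haar
  have hstabC : ∀ τ ∈ PartiteT.cells X n, IsOpen (MulAction.stabilizer G τ : Set G) ∧
      IsCompact (MulAction.stabilizer G τ : Set G) := fun τ hτ => hstab τ (Or.inr hτ)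
  have hstabP : ∀ τ ∈ PartiteT.cells X ((n : ℤ) - 1),
      IsOpen (MulAction.stabilizer G τ : Set G) ∧
      IsCompact (MulAction.stabilizer G τ : Set G) := fun τ hτ => hstab τ (Or.inl (Or.inr hτ))
  have hfin := fun i σ hσ => PartiteT.finite_panel hpart hlink hact hcocompact
    (fun τ hτ => (hstabC τ hτ).1) (fun τ hτ => (hstabP τ hτ).2) i (σ := σ) hσ
  obtain ⟨lam, hlam, hleast, hA⟩ := PartiteT.exists_isLeast_eigenvalue hpos
  have hr0 : 0 ≤ Real.sqrt (((n : ℝ) + 1) / lam) := Real.sqrt_nonneg _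
  constructor
  · obtain ⟨S, hS, hSfin, hStype⟩ := PartiteT.exists_typePreserving_subgroup hpure hpart hgal hact
      (fun τ hτ => (hstabC τ hτ).1) (fun τ hτ => (hstabP τ hτ).1)
    have hactS : PartiteT.ActsOn S X := fun g => hact g.1
    have hSemb := hS.isOpenEmbedding_subtypeVal
    -- Haar measure of `G` restricts to the open subgroup `S` and stays invariant on both sides, so
    -- `S` needs no unimodularity argument of its own.
    have hν1 : (Measure.comap S.subtype (Measure.haar : Measure G)).IsHaarMeasure :=
      Measure.IsHaarMeasure.comap (mH := inferInstance) _ (f := S.subtype) hSemb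
    have hν2 : (Measure.comap S.subtype (Measure.haar : Measure G)).IsMulRightInvariant :=
      Measure.IsMulRightInvariant.comap _ (f := S.subtype) hSemb.measurableEmbedding
    obtain ⟨D, hD⟩ := PartiteT.exists_isFundamentalDomain hactS n
    have hDfin : D.Finite := hD.finite_of_finiteIndex hcocompact
    have hstabS := fun τ hτ => PartiteT.isOpen_isCompact_stabilizer_subgroup hS
      (hstabC τ hτ).1 (hstabC τ hτ).2
    have hstabSP := fun τ hτ => (PartiteT.isOpen_isCompact_stabilizer_subgroup hS
      (hstabP τ hτ).1 (hstabP τ hτ).2).2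
    -- With r the square root, an `S`-invariant vector lies within δ(1 + r) of `x`, and the coset
    -- representatives cost another δ; this explains 1/(2 + r).
    refine ⟨Subtype.val '' PartiteT.kazhdanSet S n D ∪ Set.range (fun q : G ⧸ S => q.out),
      1 / (2 + Real.sqrt (((n : ℝ) + 1) / lam)),
      ((PartiteT.isCompact_kazhdanSet hDfin hD.1 hstabSP).image continuous_subtype_val).union
        (Set.finite_range _).isCompact, by positivity, ?_⟩
    intro H _ _ _ π _ hinv x hx
    let _ : InnerProductSpace ℝ H := InnerProductSpace.complexToReal
    set K := Subtype.val '' PartiteT.kazhdanSet S n D ∪ Set.range (fun q : G ⧸ S => q.out)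
    obtain ⟨z, hz, hxz⟩ := PartiteT.exists_invariant_norm_sub_le_of_linkMatrix
      (Measure.comap S.subtype (Measure.haar : Measure G)) hpure hpart hgal hlink hactS hStype
      hstabS hfin hpos hlam hA hDfin hD ((PartiteT.realRep π).comp S.subtype) (x := x)
      (δ := ⨆ g : K, ‖π g x - x‖)
      fun g hg => PartiteT.norm_sub_le_iSup π K x (Or.inl ⟨g, hg, rfl⟩)
    have h := PartiteT.norm_le_of_finiteIndex π hinv S (x := x) (z := z)
      (fun s hs => hz ⟨s, hs⟩)
      fun q => PartiteT.norm_sub_le_iSup π K x (Or.inr ⟨q, rfl⟩)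
    rw [hx] at h
    rw [div_le_iff₀ (by positivity)]
    linarith
  · intro htype
    refine ⟨lam, hlam, hleast, fun D hD => ?_⟩
    have hDfin : D.Finite := by
      obtain ⟨F, hF, -, hF'⟩ := hcocompact
      exact hD.finite hF fun σ hσ => hF' σ (PartiteT.mem_faces_of_mem_cells hσ)
    refine ⟨PartiteT.isCompact_kazhdanSet hDfin hD.1 fun τ hτ => (hstabP τ hτ).2, ?_⟩
    intro H _ _ _ π _ hinv x hx
    let _ : InnerProductSpace ℝ H := InnerProductSpace.complexToReal
    obtain ⟨z, hz, hxz⟩ := PartiteT.exists_invariant_norm_sub_le_of_linkMatrix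
      (Measure.haar : Measure G) hpure hpart hgal hlink hact htype
      hstabC hfin hpos hlam hA hDfin hD (PartiteT.realRep π) (x := x)
      (δ := ⨆ g : PartiteT.kazhdanSet G n D, ‖π g x - x‖)
      fun g hg => PartiteT.norm_sub_le_iSup π _ x hg
    -- Since `z = 0`, the estimate reads 1 ≤ δ(1 + r), twice as strong as what remains to be shown.
    rw [hinv z hz, sub_zero, hx] at hxz
    rw [div_le_iff₀ (by positivity)]
    nlinarith
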